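/- For each $N\ge 1$ let $E_N$ be a finite set, $\{\eta^N(t):t\ge 0\}$ an irreducible continuous-time Markov chain on $E_N$, and $\theta_N>0$. Let $\xi^N(t)=\eta^N(t\theta_N)$ be the speeded-up chain, $\mathbb P_\eta$ its law when started from $\eta$, $\lambda_N(\eta)$ its holding rates, and $\mu_N$ its stationary state. Let $S=\{1,\dots,\mathfrak n\}$, $\mathfrak n\ge 2$, let $\mathcal E^x_N$, $x\in S$, be pairwise disjoint subsets of $E_N$ (the wells), and let $\mathcal B^x_N\subset\mathcal E^x_N$ be non-empty. Put $\mu^x_N(\cdot)=\mu_N(\,\cdot\cap\mathcal E^x_N)/\mu_N(\mathcal E^x_N)$. For $\mathcal A\subset E_N$ let $H_{\mathcal A}=\inf\{t>0:\xi^N(t)\in\mathcal A\}$ and $H^+_{\mathcal A}=\inf\{t>\tau_1:\xi^N(t)\in\mathcal A\}$, where $\tau_1$ is the time of the first jump of $\xi^N$; for $\mathcal A\subset\mathcal C$ let $H^{\mathcal C}_{\mathcal A}=\int_0^{H_{\mathcal A}}\mathbf 1\{\xi^N(s)\in\mathcal C\}\,ds$. For $\eta\notin\mathcal A$ let $$\mathrm{Cap}_N(\eta,\mathcal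 A)=\mu_N(\eta)\,\lambda_N(\eta)\,\mathbb P_\eta\big[H_{\mathcal A}<H^+_{\{\eta\}}\big].$$ The trace of $\xi^N$ on $\mathcal E^x_N$ is the process $\xi^N_{T,x}(t)=\xi^N(S(t))$, where $S(t)=\sup\{s\ge 0:\int_0^s\mathbf 1\{\xi^N(u)\in\mathcal E^x_N\}\,du\le t\}$. Let $\mathcal S^{T,x}_N(t)$ be its semigroup, and $$T^{N,T,x}_{\rm mix}=\inf\Big\{t>0:\max_{\eta\in\mathcal E^x_N}\big\|\delta_\eta\mathcal S^{T,x}_N(t)-\mu^x_N\big\|_{\rm TV}\le\tfrac1{2e}\Big\}$$ its $(\frac1{2e})$-mixing time, where $\|\mu-\nu\|_{\rm TV}=\frac12\sum_\eta|\mu(\eta)-\nu(\eta)|$. Condition (M1) is: for every $\delta>0$, $$\lim_{N\to\infty}\ \max_{x\in S}\ \sup_{\eta\in\mathcal E^x_N}\mathbb P_\eta\big[H^{\mathcal E^x_N}_{\mathcal B^x_N}>\delta\big]=0 .$$ Suppose that for every $x\in S$ at least one of the following holds: $$\lim_{N\to\infty}\ \sup_{\eta\in\mathcal E^x_N\setminus\mathcal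 B^x_N}\frac{\mu_N(\mathcal E^x_N\setminus\mathcal B^x_N)}{\mathrm{Cap}_N(\eta,\mathcal B^x_N)}=0,\tag{a}$$ $$\lim_{N\to\infty}\frac{T^{N,T,x}_{\rm mix}}{\mu^x_N(\mathcal B^x_N)}\Big(1+\ln\frac1{\mu^x_N(\mathcal B^x_N)}\Big)=0.\tag{b}$$ (The supremum in (a) is $0$ if $\mathcal E^x_N=\mathcal B^x_N$.) Then (M1) holds. If, moreover, the chains $\eta^N$ are reversible, then the same is true with (b) replaced by $$\lim_{N\to\infty}\frac{T^{N,T,x}_{\rm mix}}{\mu^x_N(\mathcal B^x_N)}=0.\tag{b$'$}$$ -/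

import Mathlib

open Filter MeasureTheory ProbabilityTheory
open scoped ENNReal NNReal Topology

noncomputable section

namespace Metastable

/-! ## Trajectories in continuous time

A trajectory is a map `ξ : ℝ → E`, of which only the restriction to `[0, ∞)` is used. -/

section Trajectories

variable {E : Type*}

/-- The hitting time `H_A = inf {t > 0 : ξ(t) ∈ A}` (equal to `∞` if `A` is not visited). -/
def hittingTime (ξ : ℝ → E) (A : Set E) : ℝ≥0∞ :=
  ⨅ (t : ℝ) (_ : 0 < t) (_ : ξ t ∈ A), ENNReal.ofReal t

/-- The time of the first jump, `τ₁ = inf {t > 0 : ξ(t) ≠ ξ(0)}`. -/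
def firstJumpTime (ξ : ℝ → E) : ℝ≥0∞ :=
  ⨅ (t : ℝ) (_ : 0 < t) (_ : ξ t ≠ ξ 0), ENNReal.ofReal t

/-- The time of the first return, `H⁺_A = inf {t > τ₁ : ξ(t) ∈ A}`. -/
def returnTime (ξ : ℝ → E) (A : Set E) : ℝ≥0∞ :=
  ⨅ (t : ℝ) (_ : 0 < t) (_ : firstJumpTime ξ < ENNReal.ofReal t) (_ : ξ t ∈ A), ENNReal.ofReal t

/-- The time spent in `A` before time `u`: `∫₀ᵘ 1{ξ(s) ∈ A} ds`, for `u ∈ [0, ∞]`. -/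
def occupationTime (ξ : ℝ → E) (A : Set E) (u : ℝ≥0∞) : ℝ≥0∞ :=
  ∫⁻ s in {s : ℝ | 0 ≤ s ∧ ENNReal.ofReal s < u}, (ξ ⁻¹' A).indicator 1 s

/-- The hitting time of `A` by the trace on `C`: `H^C_A = ∫₀^{H_A} 1{ξ(s) ∈ C} ds`. -/
def traceHittingTime (ξ : ℝ → E) (C A : Set E) : ℝ≥0∞ :=
  occupationTime ξ C (hittingTime ξ A)

/-- The generalized inverse `S_A(t) = sup {s ≥ 0 : T_A(s) ≤ t}` of the time `T_A(s)` spent in `A`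
before time `s`. It is finite along the trajectories which spend an infinite time in `A`, which is
almost surely the case for an irreducible chain on a finite set and a non-empty `A`. -/
def occupationInverse (ξ : ℝ → E) (A : Set E) (t : ℝ) : ℝ :=
  sSup {s : ℝ | 0 ≤ s ∧ occupationTime ξ A (ENNReal.ofReal s) ≤ ENNReal.ofReal t}

/-- The trace of the trajectory `ξ` on `A`: `ξ^A(t) = ξ(S_A(t))`. -/
def trace (ξ : ℝ → E) (A : Set E) (t : ℝ) : E :=
  ξ (occupationInverse ξ A t)

end Trajectories

/-! ## Continuous-time Markov chains on a finite set -/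

/-- The jump rates of a continuous-time Markov chain on `E`: `rate η ζ` is the rate of the jump
from `η` to `ζ ≠ η`. -/
structure JumpRates (E : Type*) where
  rate : E → E → ℝ≥0
  rate_self : ∀ η, rate η η = 0

namespace JumpRates

section Basic

variable {E : Type*}

/-- The jump rates of the chain speeded-up by `θ`. -/
def speedUp (R : JumpRates E) (θ : ℝ≥0) : JumpRates E where
  rate η ζ := θ * R.rate η ζ
  rate_self η := by simp [R.rate_self]

/-- Every configuration can be reached from every other one through jumps of positive rate. -/
def Irreducible (R : JumpRates E) : Prop :=
  ∀ η ζ, Relation.ReflTransGen (fun a b => 0 < R.rate a b) η ζ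

/-- Detailed balance with respect to `μ`. -/
def Reversible (R : JumpRates E) (μ : E → ℝ≥0) : Prop :=
  ∀ η ζ, μ η * R.rate η ζ = μ ζ * R.rate ζ η

variable [Fintype E]

/-- The holding rate `λ(η) = ∑ ζ, R(η, ζ)`. -/
def holdingRate (R : JumpRates E) (η : E) : ℝ≥0 := ∑ ζ, R.rate η ζ

/-- `μ` is a stationary probability distribution of the chain. -/
structure IsStationary (R : JumpRates E) (μ : E → ℝ≥0) : Prop where
  sum_eq_one : ∑ η, μ η = 1
  balance : ∀ ζ, ∑ η, μ η * R.rate η ζ = μ ζ * R.holdingRate ζ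

open scoped Classical in
/-- The law of the configuration after a jump from `η`: it is `ζ` with probability
`R(η, ζ) / λ(η)`. If `η` is absorbing (`λ(η) = 0`), it is `η` itself. -/
def jumpPMF (R : JumpRates E) (η : E) : PMF E :=
  if h : R.holdingRate η = 0 then PMF.pure η
  else PMF.ofFintype (fun ζ => ((R.rate η ζ / R.holdingRate η : ℝ≥0) : ℝ≥0∞)) (by
    rw [← ENNReal.ofNNReal_finsetSum, ← Finset.sum_div]
    change ((R.holdingRate η / R.holdingRate η : ℝ≥0) : ℝ≥0∞) = 1
    rw [div_self h, ENNReal.coe_one])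

end Basic

section Law

variable {E : Type*} [Fintype E] [MeasurableSpace E] [MeasurableSingletonClass E]

/-- The transition kernel of the embedded jump chain. -/
def jumpKernel (R : JumpRates E) : Kernel E E :=
  Kernel.ofFunOfCountable fun η => (R.jumpPMF η).toMeasure

instance (R : JumpRates E) : IsMarkovKernel R.jumpKernel :=
  ⟨fun η => inferInstanceAs (IsProbabilityMeasure (R.jumpPMF η).toMeasure)⟩

/-- The law of the embedded (discrete-time) jump chain `Y₀, Y₁, …` started from `η`. -/
def jumpChainLaw (R : JumpRates E) (η : E) : Measure (ℕ → E) :=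
  Kernel.traj (X := fun _ => E)
    (fun n => R.jumpKernel.comap (fun h : (i : Finset.Iic n) → E => h ⟨n, by simp⟩)
      (measurable_pi_apply _))
    0 (fun _ => η)

/-- The sample space of the chain: a point is a pair `(Y, e)`, where `Y` is the sequence of
configurations successively visited and `e k / λ(Y k)` is the holding time at the `k`-th one. -/
abbrev Sample (E : Type*) : Type _ := (ℕ → E) × (ℕ → ℝ)

/-- The probability `P_η`: the configurations visited form the jump chain started from `η`, and,
independently, the variables `e k` are independent exponential variables of mean `1`. Hence, given
the configurations visited, the holding times `e k / λ(Y k)` are independent exponential variables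
of parameters `λ(Y k)`. -/
def law (R : JumpRates E) (η : E) : Measure (Sample E) :=
  (R.jumpChainLaw η).prod (Measure.infinitePi fun _ => expMeasure 1)

/-- The time of the `n`-th jump, `∑_{k < n} e k / λ(Y k)`. The holding time at an absorbing
configuration is infinite. -/
def jumpTime (R : JumpRates E) (ω : Sample E) (n : ℕ) : ℝ≥0∞ :=
  ∑ k ∈ Finset.range n, ENNReal.ofReal (ω.2 k) / (R.holdingRate (ω.1 k) : ℝ≥0∞)

/-- The continuous-time Markov chain with jump rates `R`: it is equal to `Y n` between the `n`-th
and the `(n+1)`-th jump times. Since `E` is finite, almost surely the jump times tend to infinity,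
so that there is such an `n`. -/
def chain (R : JumpRates E) (ω : Sample E) (t : ℝ) : E :=
  ω.1 (sInf {n : ℕ | ENNReal.ofReal t < R.jumpTime ω (n + 1)})

/-- The capacity `Cap(A, B) = ∑_{η ∈ A} μ(η) λ(η) P_η[H_B < H⁺_A]`. -/
def capacity (R : JumpRates E) (μ : E → ℝ≥0) (A B : Finset E) : ℝ≥0∞ :=
  ∑ η ∈ A, (μ η : ℝ≥0∞) * R.holdingRate η *
    R.law η {ω | hittingTime (R.chain ω) B < returnTime (R.chain ω) A}

/-- The transition probabilities of the trace process on `A`: `P_η[ξ^A(t) = ζ]`. As a function of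
`ζ`, this is `δ_η S(t)` with `S` the semigroup of the trace process on `A`. -/
def traceSemigroup (R : JumpRates E) (A : Set E) (t : ℝ) (η ζ : E) : ℝ :=
  (R.law η).real {ω | trace (R.chain ω) A t = ζ}

end Law

end JumpRates

/-! ## Conditioned stationary state and mixing time -/

section Mixing

variable {E : Type*}

/-- The measure of the set `A` under the distribution `μ`. -/
def mass (μ : E → ℝ≥0) (A : Finset E) : ℝ≥0 := ∑ η ∈ A, μ η

open scoped Classical in
/-- The distribution `μ` conditioned to `A`. -/
def conditioned (μ : E → ℝ≥0) (A : Finset E) (η : E) : ℝ≥0 :=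
  if η ∈ A then μ η / mass μ A else 0

/-- The total variation distance `(1/2) ∑ η, |p(η) - q(η)|`. -/
def tvDist [Fintype E] (p q : E → ℝ) : ℝ := (1 / 2) * ∑ η, |p η - q η|

/-- The `(1/2e)`-mixing time of the trace process on `A`: the infimum of the `t > 0` for which
`max_{η ∈ A} ‖δ_η S(t) - μ(· | A)‖_TV ≤ 1/(2e)`. -/
def traceMixingTime [Fintype E] [MeasurableSpace E] [MeasurableSingletonClass E]
    (R : JumpRates E) (μ : E → ℝ≥0) (A : Finset E) : ℝ≥0∞ :=
  ⨅ (t : ℝ) (_ : 0 < t)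
    (_ : ∀ η ∈ A, tvDist (R.traceSemigroup A t η) (fun ζ => (conditioned μ A ζ : ℝ))
      ≤ 1 / (2 * Real.exp 1)),
    ENNReal.ofReal t

end Mixing

/-! ## The conditions on the wells

Here `R N` are the jump rates of the `N`-th chain (in the time-scale in which it is observed), `μ N`
is its stationary state, `W N` or `W N x` are wells, and `B N` or `B N x` are subsets of them. -/

section Conditions

variable {E : ℕ → Type*} [∀ N, Fintype (E N)] [∀ N, MeasurableSpace (E N)]
  [∀ N, MeasurableSingletonClass (E N)]

/-- Condition (M1): for every `δ > 0`,
`lim_N max_x sup_{η ∈ W N x} P_η[H_{B N x}^{W N x} > δ] = 0`. -/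
def ConditionM1 {S : Type*} (R : ∀ N, JumpRates (E N)) (W B : ∀ N, S → Finset (E N)) : Prop :=
  ∀ δ : ℝ, 0 < δ → Tendsto
    (fun N => ⨆ x : S, ⨆ η ∈ W N x,
      (R N).law η {ω | ENNReal.ofReal δ <
        traceHittingTime ((R N).chain ω) (W N x : Set (E N)) (B N x : Set (E N))})
    atTop (𝓝 0)

/-- `lim_N sup_{η ∈ W N ∖ B N} μ_N(W N ∖ B N) / Cap_N(η, B N) = 0`. -/
def CapacityCondition [∀ N, DecidableEq (E N)] (R : ∀ N, JumpRates (E N)) (μ : ∀ N, E N → ℝ≥0)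
    (W B : ∀ N, Finset (E N)) : Prop :=
  Tendsto
    (fun N => ⨆ η ∈ W N \ B N,
      (mass (μ N) (W N \ B N) : ℝ≥0∞) / (R N).capacity (μ N) {η} (B N))
    atTop (𝓝 0)

/-- `lim_N (T_mix / μ(B N | W N)) (1 + ln (1 / μ(B N | W N))) = 0`, with `T_mix` the mixing time of
the trace process on `W N`. -/
def MixingCondition (R : ∀ N, JumpRates (E N)) (μ : ∀ N, E N → ℝ≥0)
    (W B : ∀ N, Finset (E N)) : Prop :=
  Tendsto
    (fun N => traceMixingTime (R N) (μ N) (W N) / (mass (conditioned (μ N) (W N)) (B N) : ℝ≥0∞) *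
      ENNReal.ofReal (1 + Real.log (1 / (mass (conditioned (μ N) (W N)) (B N) : ℝ))))
    atTop (𝓝 0)

/-- `lim_N T_mix / μ(B N | W N) = 0`, with `T_mix` the mixing time of the trace process on
`W N`. -/
def MixingConditionNoLog (R : ∀ N, JumpRates (E N)) (μ : ∀ N, E N → ℝ≥0)
    (W B : ∀ N, Finset (E N)) : Prop :=
  Tendsto
    (fun N => traceMixingTime (R N) (μ N) (W N) / (mass (conditioned (μ N) (W N)) (B N) : ℝ≥0∞))
    atTop (𝓝 0)

end Conditions

end Metastable

end

noncomputable section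

namespace Metastable

/-! Fix one chain, a well W and B ⊆ W. Everything rests on the mean time g(η) spent in W before
hitting B: Markov's inequality gives δ · P_η[H^W_B > δ] ≤ g(η) up to null sets, and g is bounded by
each of the ratios in (a), (b), (b') times a universal constant.

The function g is never computed as an expectation. It is defined as the solution of a Dirichlet
problem for the jump matrix p, namely g = 0 on B and g - pg = 1_W / λ off B (`IsMeanTime`). On the
probabilistic side, the trace on W killed on reaching B satisfies a renewal equation at its first
jump, and uniqueness for linear ODEs identifies its semigroup with exp(tA), where A is the trace
generator written with the harmonic extension from W (`stayProb_eq_semigroup`). Since A g = -1 on W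
∖ B, the derivative of exp(sA) g is minus the probability of not having reached B by time s
(`IsMeanTime.hasDerivAt`). This is Dynkin's formula, and Markov's inequality follows because that
probability decreases in s (`IsMeanTime.mul_stayProb_le`). Conservativeness of the same semigroup
yields non-explosion and the infinite time spent in W, so that the pathwise definitions can be read
off the jump chain almost surely.

Under (a), let k(ζ) be the probability that the adjoint chain started from ζ reaches η before B.
Pairing k with g - pg in the measure μλ gives at most μ(W ∖ B), as k ≤ 1. Moving the operator to k
gives g(η) times the capacity of the adjoint chain, and the same duality shows that this is the
capacity of the chain itself (`IsMeanTime.mul_le`).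

Under (b) and (b'), suppose that from every point of W the trace is in B at time T with probability
at least c. Dynkin's formula at the maximum of g then gives g ≤ T / c (`mul_stayProb_le_div`). In
general, each mixing time divides oscillations by e, so about ln(2/π(B)) mixing times, with π = μ(·
| W), give c = π(B)/2 (`IsMixedAt.le_stayProb`); this is the source of the logarithm. For reversible
chains two mixing times suffice: a Cauchy–Schwarz argument bounds the kernel at that time below by
π/4 (`IsMixedAt.le_stayProb_of_reversible`). -/

/-! ### The Markov property at the first jump. -/

/-- The sequence `a, f 0, f 1, …`. -/
def seqCons {α : Type*} (a : α) (f : ℕ → α) : ℕ → α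
  | 0 => a
  | n + 1 => f n

@[simp] lemma seqCons_zero {α : Type*} (a : α) (f : ℕ → α) : seqCons a f 0 = a := rfl

@[simp] lemma seqCons_succ {α : Type*} (a : α) (f : ℕ → α) (n : ℕ) :
    seqCons a f (n + 1) = f n := rfl

lemma measurable_seqCons {α : Type*} [MeasurableSpace α] :
    Measurable fun p : α × (ℕ → α) => seqCons p.1 p.2 := by
  refine measurable_pi_lambda _ fun n => ?_
  cases n with
  | zero => exact measurable_fst
  | succ n => exact (measurable_pi_apply n).comp measurable_snd

/-- A product of copies of a probability measure, indexed by `ℕ`, is the law of a first coordinate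
followed by an independent sequence with the same law. -/
lemma infinitePi_eq_map_seqCons {α : Type*} [MeasurableSpace α] (m : Measure α)
    [IsProbabilityMeasure m] :
    Measure.infinitePi (fun _ : ℕ => m) =
      (m.prod (Measure.infinitePi fun _ : ℕ => m)).map fun p => seqCons p.1 p.2 := by
  symm
  refine Measure.eq_infinitePi _ fun s t ht => ?_
  rw [Measure.map_apply measurable_seqCons (MeasurableSet.pi s.countable_toSet fun i _ => ht i)]
  classical
  -- Filling the missing coordinates with the whole space turns the finite set `s` into an initial
  -- segment, from which the coordinate 0 can be split off.
  set t' : ℕ → Set α := fun i => if i ∈ s then t i else Set.univ with ht'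
  have ht'm : ∀ i, MeasurableSet (t' i) := fun i => by
    simp only [ht']; split_ifs; exacts [ht i, MeasurableSet.univ]
  obtain ⟨N, hN⟩ : ∃ N, ∀ i ∈ s, i < N + 1 :=
    ⟨s.sup id, fun i hi => Nat.lt_succ_of_le (Finset.le_sup (f := id) hi)⟩
  have hset : (fun p : α × (ℕ → α) => seqCons p.1 p.2) ⁻¹' (Set.pi s t) =
      t' 0 ×ˢ Set.pi (Finset.range N) fun i => t' (i + 1) := by
    ext p
    simp only [Set.mem_preimage, Set.mem_pi, Set.mem_prod, Finset.coe_range, Set.mem_Iio,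
      Finset.mem_coe, ht']
    constructor
    · intro h
      refine ⟨?_, fun i _ => ?_⟩
      · split_ifs with h0
        · exact h 0 h0
        · trivial
      · split_ifs with h0
        · exact h (i + 1) h0
        · trivial
    · rintro ⟨h0, h1⟩ i hi
      cases i with
      | zero => simpa [hi] using h0
      | succ i => simpa [hi] using h1 i (by have := hN _ hi; omega)
  rw [hset, Measure.prod_prod, Measure.infinitePi_pi _ fun i _ => ht'm _]
  have : ∏ i ∈ s, m (t i) = ∏ i ∈ Finset.range (N + 1), m (t' i) := by
    rw [← Finset.prod_subset (s₁ := s) (fun i hi => Finset.mem_range.2 (hN i hi))]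
    · exact Finset.prod_congr rfl fun i hi => by simp [ht', hi]
    · intro i _ hi
      simp [ht', hi]
  rw [this, Finset.prod_range_succ', mul_comm]

/-- Two finite measures on the sequences in a countable discrete space which agree on the cylinders
fixing the first coordinates are equal. -/
lemma measure_ext_of_cylinder {E : Type*} [Countable E] [MeasurableSpace E]
    [MeasurableSingletonClass E] (m m' : Measure (ℕ → E)) [IsFiniteMeasure m]
    (h : ∀ (n : ℕ) (a : ℕ → E), m {Y | ∀ i ≤ n, Y i = a i} = m' {Y | ∀ i ≤ n, Y i = a i}) :
    m = m' := by
  have key : ∀ n, m.map (Preorder.frestrictLe n) = m'.map (Preorder.frestrictLe n) := by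
    intro n
    refine Measure.ext_of_singleton fun b => ?_
    rw [Measure.map_apply (by fun_prop) (measurableSet_singleton b),
      Measure.map_apply (by fun_prop) (measurableSet_singleton b)]
    -- The values of `a` beyond n play no role; `b` at 0 only serves as an available element of E.
    let a : ℕ → E := fun i => if hi : i ≤ n then b ⟨i, Finset.mem_Iic.2 hi⟩ else b ⟨0, by simp⟩
    have : (Preorder.frestrictLe n : (ℕ → E) → _) ⁻¹' {b} = {Y | ∀ i ≤ n, Y i = a i} := by
      ext Y
      simp only [Set.mem_preimage, Set.mem_singleton_iff, Set.mem_ofPred_eq, funext_iff]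
      constructor
      · intro hY i hi
        have := hY ⟨i, Finset.mem_Iic.2 hi⟩
        simpa [a, hi] using this
      · rintro hY ⟨i, hi⟩
        have hi' := Finset.mem_Iic.1 hi
        simpa [a, hi'] using hY i hi'
    rw [this, h]
  have h1 : IsProjectiveLimit m (fun I : Finset ℕ => m.map I.restrict) := fun I => rfl
  have h2 : IsProjectiveLimit m' (fun I : Finset ℕ => m.map I.restrict) := by
    rw [isProjectiveLimit_nat_iff]
    · intro n
      exact (key n).symm
    · intro I J hJI
      rw [Measure.map_map (by fun_prop) (by fun_prop)]
      rfl
  have : ∀ I : Finset ℕ, IsFiniteMeasure (m.map I.restrict) := fun I => inferInstance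
  exact h1.unique h2

namespace JumpRates

variable {E : Type*} [Fintype E] [MeasurableSpace E] [MeasurableSingletonClass E]

lemma jumpKernel_singleton (R : JumpRates E) (η ζ : E) :
    R.jumpKernel η {ζ} = R.jumpPMF η ζ :=
  PMF.toMeasure_apply_singleton _ _ (measurableSet_singleton ζ)

-- The path formula: each further step of the trajectory kernel multiplies the weight of a cylinder
-- by one transition probability. As cylinders determine the law, this is all that is retained of
-- the construction by `Kernel.traj`.
open scoped Classical in
lemma jumpChainLaw_cylinder (R : JumpRates E) (η : E) (a : ℕ → E) (n : ℕ) :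
    R.jumpChainLaw η {Y | ∀ i ≤ n, Y i = a i} =
      (if a 0 = η then 1 else 0) * ∏ i ∈ Finset.range n, R.jumpPMF (a i) (a (i + 1)) := by
  let κ : (n : ℕ) → Kernel ((i : Finset.Iic n) → E) E :=
    fun n => R.jumpKernel.comap (fun h : (i : Finset.Iic n) → E => h ⟨n, by simp⟩)
      (measurable_pi_apply _)
  have : ∀ n, IsMarkovKernel (κ n) := fun n => inferInstance
  have hset : ∀ n, {Y : ℕ → E | ∀ i ≤ n, Y i = a i} =
      (Preorder.frestrictLe n : (ℕ → E) → _) ⁻¹' {Preorder.frestrictLe n a} := by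
    intro n
    ext Y
    simp [funext_iff]
  have hm : ∀ n, R.jumpChainLaw η {Y : ℕ → E | ∀ i ≤ n, Y i = a i} =
      Kernel.partialTraj (X := fun _ => E) κ 0 n (fun _ => η) {Preorder.frestrictLe n a} := by
    intro n
    rw [hset, ← Measure.map_apply (by fun_prop) (measurableSet_singleton _)]
    exact congrArg (fun m : Measure _ => m {Preorder.frestrictLe n a})
      (Kernel.traj_map_frestrictLe_apply (X := fun _ => E) (κ := κ) 0 n (fun _ => η))
  induction n with
  | zero =>
    rw [hm, Kernel.partialTraj_self, Kernel.id_apply, Measure.dirac_apply]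
    simp only [Finset.range_zero, Finset.prod_empty, mul_one, Set.indicator_apply,
      Set.mem_singleton_iff, Pi.one_apply]
    congr 1
    simp only [funext_iff, eq_iff_iff]
    constructor
    · intro h; exact (h ⟨0, by simp⟩).symm
    · rintro h ⟨i, hi⟩
      have : i = 0 := by simpa using hi
      subst this; exact h.symm
  | succ n ih =>
    rw [Finset.prod_range_succ, ← mul_assoc, ← ih, hm, hm,
      Kernel.partialTraj_succ_eq_comp (Nat.zero_le n), Kernel.comp_apply,
      Measure.bind_apply (measurableSet_singleton _) (Kernel.aemeasurable _)]
    -- The kernel from n to n + 1 keeps the past and draws one new coordinate, so it charges the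
    -- cylinder only when the past already agrees with `a`.
    have hx : ∀ x : (i : Finset.Iic n) → E,
        Kernel.partialTraj (X := fun _ => E) κ n (n + 1) x {Preorder.frestrictLe (n + 1) a} =
        Set.indicator {Preorder.frestrictLe n a} (fun _ => R.jumpPMF (a n) (a (n + 1))) x := by
      intro x
      rw [Kernel.partialTraj_succ_self, Kernel.map_apply' _ (by fun_prop) _
        (measurableSet_singleton _)]
      have hpre : (IicProdIoc (X := fun _ => E) n (n + 1)) ⁻¹' {Preorder.frestrictLe (n + 1) a} =
          {Preorder.frestrictLe n a} ×ˢ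
            {fun i : Finset.Ioc n (n + 1) => a i} := by
        ext p
        simp only [Set.mem_preimage, Set.mem_singleton_iff, Set.mem_prod, funext_iff, IicProdIoc]
        constructor
        · intro h
          refine ⟨fun i => ?_, fun i => ?_⟩
          · have hi := Finset.mem_Iic.1 i.2
            have := h ⟨i, Finset.mem_Iic.2 (hi.trans (Nat.le_succ n))⟩
            simpa [hi] using this
          · have hi := Finset.mem_Ioc.1 i.2
            have := h ⟨i, Finset.mem_Iic.2 hi.2⟩
            simpa [not_le.2 hi.1] using this
        · rintro ⟨h1, h2⟩ ⟨i, hi⟩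
          have hi' := Finset.mem_Iic.1 hi
          by_cases hin : i ≤ n
          · simpa [hin] using h1 ⟨i, Finset.mem_Iic.2 hin⟩
          · simpa [hin] using h2 ⟨i, Finset.mem_Ioc.2 ⟨not_le.1 hin, hi'⟩⟩
      rw [hpre, Kernel.prod_apply, Measure.prod_prod, Kernel.id_apply, Measure.dirac_apply,
        Kernel.map_apply' _ (MeasurableEquiv.measurable _) _ (measurableSet_singleton _)]
      have hpre2 : (MeasurableEquiv.piSingleton (X := fun _ => E) n) ⁻¹'
          {fun i : Finset.Ioc n (n + 1) => a i} = {a (n + 1)} := by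
        ext z
        simp only [Set.mem_preimage, Set.mem_singleton_iff, funext_iff]
        constructor
        · intro h
          exact h ⟨n + 1, by simp⟩
        · rintro rfl ⟨i, hi⟩
          have : i = n + 1 := by
            have := Finset.mem_Ioc.1 hi; omega
          subst this
          rfl
      rw [hpre2]
      by_cases hxa : x = Preorder.frestrictLe n a
      · subst hxa
        simp only [Set.indicator_apply, Set.mem_singleton_iff, if_true, Pi.one_apply, one_mul]
        exact R.jumpKernel_singleton _ _
      · simp [hxa]
    simp only [hx]
    rw [lintegral_indicator_const (measurableSet_singleton _), mul_comm]

instance (R : JumpRates E) (η : E) : IsProbabilityMeasure (R.jumpChainLaw η) := by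
  unfold jumpChainLaw; infer_instance

instance : IsProbabilityMeasure (expMeasure 1) := isProbabilityMeasure_expMeasure one_pos

instance (R : JumpRates E) (η : E) : IsProbabilityMeasure (R.law η) := by
  unfold law; infer_instance

/-- The Markov property of the jump chain at its first jump. -/
lemma jumpChainLaw_eq_sum (R : JumpRates E) (η : E) :
    R.jumpChainLaw η = ∑ ζ, R.jumpPMF η ζ • (R.jumpChainLaw ζ).map (seqCons η) := by
  classical
  have hmeas : Measurable (seqCons η : (ℕ → E) → ℕ → E) :=
    measurable_seqCons.comp measurable_prodMk_left
  refine measure_ext_of_cylinder _ _ fun n a => ?_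
  have hms : ∀ n, MeasurableSet {Y : ℕ → E | ∀ i ≤ n, Y i = a i} := by
    intro n
    simp only [Set.ofPred_forall]
    exact MeasurableSet.iInter fun i => MeasurableSet.iInter fun _ =>
      measurableSet_eq_fun (measurable_pi_apply i) measurable_const
  rw [Measure.finsetSum_apply]
  simp only [Measure.smul_apply, smul_eq_mul, Measure.map_apply hmeas (hms n)]
  rw [jumpChainLaw_cylinder]
  cases n with
  | zero =>
    have : ∀ ζ, R.jumpChainLaw ζ (seqCons η ⁻¹' {Y : ℕ → E | ∀ i ≤ 0, Y i = a i}) =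
        if a 0 = η then 1 else 0 := by
      intro ζ
      split_ifs with h
      · have : seqCons η ⁻¹' {Y : ℕ → E | ∀ i ≤ 0, Y i = a i} = Set.univ := by
          ext Y; simp [h]
        rw [this, measure_univ]
      · have : seqCons η ⁻¹' {Y : ℕ → E | ∀ i ≤ 0, Y i = a i} = ∅ := by
          ext Y; simp [Ne.symm h]
        rw [this, measure_empty]
    simp only [this, ← Finset.sum_mul]
    have h1 : ∑ ζ, R.jumpPMF η ζ = 1 := by
      rw [← tsum_fintype (L := .unconditional _)]; exact PMF.tsum_coe _
    simp [h1]
  | succ n =>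
    by_cases h : a 0 = η
    · have : seqCons η ⁻¹' {Y : ℕ → E | ∀ i ≤ n + 1, Y i = a i} =
          {Y : ℕ → E | ∀ i ≤ n, Y i = a (i + 1)} := by
        ext Y
        simp only [Set.mem_preimage, Set.mem_ofPred_eq]
        constructor
        · intro hY i hi
          exact hY (i + 1) (by omega)
        · intro hY i hi
          cases i with
          | zero => exact h.symm
          | succ i => exact hY i (by omega)
      rw [this]
      simp only [jumpChainLaw_cylinder R _ (fun i => a (i + 1))]
      rw [Finset.prod_range_succ', if_pos h, one_mul, Finset.sum_eq_single (a 1)]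
      · simp [h, mul_comm]
      · intro b _ hb
        simp [Ne.symm hb]
      · simp
    · have : seqCons η ⁻¹' {Y : ℕ → E | ∀ i ≤ n + 1, Y i = a i} = ∅ := by
        ext Y
        simp only [Set.mem_preimage, Set.mem_ofPred_eq, Set.mem_empty_iff_false, iff_false]
        intro hY
        exact h (hY 0 (by omega)).symm
      rw [this]
      simp [h]

/-- The Markov property at the first jump: under `law η`, the configuration after the jump, the
variable of the first holding time and the rest of the sample are as described by the rates. -/
lemma law_apply_eq_lintegral (R : JumpRates E) (η : E) {Γ : Set (Sample E)}
    (hΓ : MeasurableSet Γ) :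
    R.law η Γ = ∫⁻ s, ∑ ζ, R.jumpPMF η ζ *
      R.law ζ {ω | ((seqCons η ω.1, seqCons s ω.2) : Sample E) ∈ Γ} ∂(expMeasure 1) := by
  set ν := Measure.infinitePi fun _ : ℕ => expMeasure 1 with hν
  have hmE : Measurable (seqCons η : (ℕ → E) → ℕ → E) :=
    measurable_seqCons.comp measurable_prodMk_left
  have hms : ∀ ζ, Measurable fun s => R.law ζ
      {ω | ((seqCons η ω.1, seqCons s ω.2) : Sample E) ∈ Γ} := by
    intro ζ
    have : MeasurableSet {p : ℝ × Sample E |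
        ((seqCons η p.2.1, seqCons p.1 p.2.2) : Sample E) ∈ Γ} := by
      refine Measurable.prodMk (hmE.comp (measurable_fst.comp measurable_snd)) ?_ hΓ
      exact measurable_seqCons.comp
        (measurable_fst.prodMk (measurable_snd.comp measurable_snd))
    exact measurable_measure_prodMk_left this
  rw [lintegral_finsetSum _ fun ζ _ => (hms ζ).const_mul _]
  -- The exponential variables are independent of the jump chain, so the two factors are decomposed
  -- separately: the chain here, the sequence of exponentials in `h1`, and Fubini puts them
  -- together.
  have hlaw : R.law η = ∑ ζ, R.jumpPMF η ζ • ((R.jumpChainLaw ζ).map (seqCons η)).prod ν := by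
    unfold law
    rw [jumpChainLaw_eq_sum, ← Measure.sum_fintype, Measure.prod_sum_left, Measure.sum_fintype]
    simp only [Measure.prod_smul_left]
    rfl
  rw [hlaw, Measure.finsetSum_apply]
  refine Finset.sum_congr rfl fun ζ _ => ?_
  rw [Measure.smul_apply, smul_eq_mul, lintegral_const_mul _ (hms ζ)]
  congr 1
  have : IsProbabilityMeasure ((R.jumpChainLaw ζ).map (seqCons η)) :=
    Measure.isProbabilityMeasure_map hmE.aemeasurable
  rw [Measure.prod_apply hΓ, lintegral_map (measurable_measure_prodMk_left hΓ) hmE]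
  have h1 : ∀ Y : ℕ → E, ν (Prod.mk (seqCons η Y) ⁻¹' Γ) =
      ∫⁻ s, ν {e | (seqCons η Y, seqCons s e) ∈ Γ} ∂(expMeasure 1) := by
    intro Y
    conv_lhs => rw [hν, infinitePi_eq_map_seqCons]
    rw [Measure.map_apply measurable_seqCons (measurable_prodMk_left hΓ), Measure.prod_apply
      (measurable_seqCons (measurable_prodMk_left hΓ))]
    rfl
  simp only [h1]
  rw [lintegral_lintegral_swap]
  · refine lintegral_congr fun s => ?_
    have hΓs : MeasurableSet {ω : Sample E |
        ((seqCons η ω.1, seqCons s ω.2) : Sample E) ∈ Γ} := by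
      refine Measurable.prodMk (hmE.comp measurable_fst) ?_ hΓ
      exact measurable_seqCons.comp (measurable_const.prodMk measurable_snd)
    unfold law
    rw [Measure.prod_apply hΓs]
    rfl
  · have : MeasurableSet {p : ((ℕ → E) × ℝ) × (ℕ → ℝ) |
        ((seqCons η p.1.1, seqCons p.1.2 p.2) : Sample E) ∈ Γ} := by
      refine Measurable.prodMk (hmE.comp (measurable_fst.comp measurable_fst)) ?_ hΓ
      exact measurable_seqCons.comp
        ((measurable_snd.comp measurable_fst).prodMk measurable_snd)
    exact (measurable_measure_prodMk_left this).aemeasurable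

end JumpRates

/-! ### Integrals against the exponential law. -/

lemma integral_expMeasure_one (f : ℝ → ℝ) :
    ∫ s, f s ∂(expMeasure 1) = ∫ s in Set.Ioi 0, Real.exp (-s) * f s := by
  have h : expMeasure 1 = volume.withDensity (exponentialPDF 1) := rfl
  have hm : Measurable (exponentialPDF 1) :=
    (measurable_exponentialPDFReal 1).ennreal_ofReal
  rw [h, integral_withDensity_eq_integral_toReal_smul hm
    (ae_of_all _ fun x => ENNReal.ofReal_lt_top), ← integral_Ici_eq_integral_Ioi,
    ← integral_indicator measurableSet_Ici]
  refine integral_congr_ae (ae_of_all _ fun s => ?_)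
  simp only [exponentialPDF_eq, Set.indicator_apply, Set.mem_Ici, one_mul, smul_eq_mul]
  split_ifs with hs
  · rw [ENNReal.toReal_ofReal (Real.exp_pos _).le]
  · simp

/-- A function equal to `a` beyond the exponential time `t`, and to `g (t - s / l)` before it, has
the following mean. -/
lemma integral_expMeasure_split {l t a C : ℝ} (hl : 0 < l) (ht : 0 ≤ t) {g : ℝ → ℝ}
    (hg : Measurable g) (hgC : ∀ s, |g s| ≤ C) :
    ∫ s, (if t < s / l then a else g (t - s / l)) ∂(expMeasure 1) =
      Real.exp (-(l * t)) * (a + l * ∫ r in (0 : ℝ)..t, Real.exp (l * r) * g r) := by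
  rw [integral_expMeasure_one]
  have hlt : 0 ≤ l * t := by positivity
  have hint : IntegrableOn (fun s => Real.exp (-s)) (Set.Ioi 0) := integrableOn_exp_neg_Ioi 0
  have hmeas : Measurable fun s => if t < s / l then a else g (t - s / l) :=
    Measurable.ite (measurableSet_lt measurable_const (by fun_prop)) measurable_const
      (hg.comp (by fun_prop))
  have hbd : ∀ s, ‖if t < s / l then a else g (t - s / l)‖ ≤ max |a| C := by
    intro s
    split_ifs
    · exact le_max_left _ _
    · exact (hgC _).trans (le_max_right _ _)
  have hint2 : IntegrableOn (fun s => Real.exp (-s) * (if t < s / l then a else g (t - s / l)))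
      (Set.Ioi 0) :=
    Integrable.mul_bdd (c := max |a| C) hint hmeas.aestronglyMeasurable (ae_of_all _ hbd)
  rw [← Set.Ioc_union_Ioi_eq_Ioi hlt, setIntegral_union (Set.Ioc_disjoint_Ioi le_rfl)
    measurableSet_Ioi (hint2.mono_set Set.Ioc_subset_Ioi_self)
    (hint2.mono_set (Set.Ioi_subset_Ioi hlt))]
  have h2 : ∫ s in Set.Ioi (l * t), Real.exp (-s) * (if t < s / l then a else g (t - s / l)) =
      Real.exp (-(l * t)) * a := by
    rw [← integral_exp_neg_Ioi, ← integral_mul_const]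
    refine setIntegral_congr_fun measurableSet_Ioi fun s hs => ?_
    have : t < s / l := by rw [lt_div_iff₀ hl, mul_comm]; exact hs
    simp [this]
  -- The change of variables r = t - s / l, the time left after the jump; the Jacobian produces the
  -- factor l.
  have h1 : ∫ s in Set.Ioc 0 (l * t), Real.exp (-s) * (if t < s / l then a else g (t - s / l)) =
      Real.exp (-(l * t)) * (l * ∫ r in (0 : ℝ)..t, Real.exp (l * r) * g r) := by
    have : ∀ s ∈ Set.Ioc 0 (l * t),
        Real.exp (-s) * (if t < s / l then a else g (t - s / l)) =
        Real.exp (-(l * t)) * (Real.exp (l * (t - s / l)) * g (t - s / l)) := by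
      intro s hs
      have h : ¬ t < s / l := by
        rw [not_lt, div_le_iff₀ hl, mul_comm]; exact hs.2
      rw [if_neg h, ← mul_assoc, ← Real.exp_add]
      congr 2
      field_simp
      ring
    rw [setIntegral_congr_fun measurableSet_Ioc this, integral_const_mul,
      ← intervalIntegral.integral_of_le hlt,
      intervalIntegral.integral_comp_sub_div (fun r => Real.exp (l * r) * g r) hl.ne' t]
    simp [hl.ne']
  rw [h1, h2]
  ring

/-! ### The killed trace process and its renewal equation. -/

namespace JumpRates

section Prob

variable {E : Type*} [Fintype E]

/-- The transition probabilities of the jump chain. -/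
def prob (R : JumpRates E) (η ζ : E) : ℝ := R.rate η ζ / R.holdingRate η

lemma prob_nonneg (R : JumpRates E) (η ζ : E) : 0 ≤ R.prob η ζ := by
  unfold prob; positivity

lemma sum_prob (R : JumpRates E) {η : E} (h : R.holdingRate η ≠ 0) : ∑ ζ, R.prob η ζ = 1 := by
  unfold prob
  rw [← Finset.sum_div]
  have : (∑ ζ, (R.rate η ζ : ℝ)) = R.holdingRate η := by simp [holdingRate]
  rw [this, div_self]
  exact_mod_cast h

lemma toReal_jumpPMF (R : JumpRates E) {η : E} (h : R.holdingRate η ≠ 0) (ζ : E) :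
    (R.jumpPMF η ζ).toReal = R.prob η ζ := by
  unfold jumpPMF prob
  rw [dif_neg h]
  simp

/-- The jump times of the trace on `W`: the time spent in `W` before the `n`-th jump. -/
def clock (R : JumpRates E) (W : Set E) (ω : Sample E) (n : ℕ) : ℝ≥0∞ :=
  ∑ k ∈ Finset.range n,
    W.indicator (fun η => ENNReal.ofReal (ω.2 k) / (R.holdingRate η : ℝ≥0∞)) (ω.1 k)

/-- The event that the trace on `W` is in `Z` at time `t`, and has not left `S` before. -/
def stayEvent (R : JumpRates E) (W S Z : Set E) (t : ℝ) : Set (Sample E) :=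
  {ω | ∃ n, R.clock W ω n ≤ ENNReal.ofReal t ∧ ENNReal.ofReal t < R.clock W ω (n + 1) ∧
    ω.1 n ∈ Z ∧ ∀ k ≤ n, ω.1 k ∈ W → ω.1 k ∈ S}

lemma clock_zero (R : JumpRates E) (W : Set E) (ω : Sample E) : R.clock W ω 0 = 0 := by
  simp [clock]

lemma clock_succ (R : JumpRates E) (W : Set E) (ω : Sample E) (n : ℕ) :
    R.clock W ω (n + 1) = R.clock W ω n +
      W.indicator (fun η => ENNReal.ofReal (ω.2 n) / (R.holdingRate η : ℝ≥0∞)) (ω.1 n) :=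
  Finset.sum_range_succ _ _

lemma clock_mono (R : JumpRates E) (W : Set E) (ω : Sample E) : Monotone (R.clock W ω) :=
  monotone_nat_of_le_succ fun n => by rw [clock_succ]; exact le_self_add

lemma clock_cons_succ (R : JumpRates E) (W : Set E) (η : E) (s : ℝ) (ω : Sample E) (n : ℕ) :
    R.clock W (seqCons η ω.1, seqCons s ω.2) (n + 1) =
      W.indicator (fun η => ENNReal.ofReal s / (R.holdingRate η : ℝ≥0∞)) η + R.clock W ω n := by
  unfold clock
  rw [Finset.sum_range_succ', add_comm]
  rfl

end Prob

variable {E : Type*} [Fintype E] [MeasurableSpace E] [MeasurableSingletonClass E]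

/-- The probability that the trace on `W` is in `Z` at time `t`, and has not left `S` before. -/
def stayProb (R : JumpRates E) (W S Z : Set E) (t : ℝ) (η : E) : ℝ :=
  (R.law η).real (R.stayEvent W S Z t)

lemma measurable_clock (R : JumpRates E) (W : Set E) (n : ℕ) :
    Measurable fun ω : Sample E => R.clock W ω n := by
  refine Finset.measurable_fun_sum _ fun k _ => ?_
  have h1 : Measurable fun ω : Sample E => ω.1 k := (measurable_pi_apply k).comp measurable_fst
  have h2 : Measurable fun ω : Sample E => ω.2 k := (measurable_pi_apply k).comp measurable_snd
  classical
  simp only [Set.indicator_apply]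
  refine Measurable.ite (h1 (Set.toFinite W).measurableSet) ?_ measurable_const
  exact h2.ennreal_ofReal.div ((measurable_of_finite fun η => (R.holdingRate η : ℝ≥0∞)).comp h1)

lemma measurableSet_stayEvent_prod (R : JumpRates E) (W S Z : Set E) :
    MeasurableSet {p : ℝ × Sample E | p.2 ∈ R.stayEvent W S Z p.1} := by
  have hY : ∀ k (A : Set E), MeasurableSet {p : ℝ × Sample E | p.2.1 k ∈ A} := fun k A =>
    ((measurable_pi_apply k).comp (measurable_fst.comp measurable_snd))
      (Set.toFinite A).measurableSet
  have ht : Measurable fun p : ℝ × Sample E => ENNReal.ofReal p.1 :=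
    measurable_fst.ennreal_ofReal
  have hc : ∀ n, Measurable fun p : ℝ × Sample E => R.clock W p.2 n :=
    fun n => (R.measurable_clock W n).comp measurable_snd
  have : {p : ℝ × Sample E | p.2 ∈ R.stayEvent W S Z p.1} =
      ⋃ n, ({p : ℝ × Sample E | R.clock W p.2 n ≤ ENNReal.ofReal p.1} ∩
      ({p | ENNReal.ofReal p.1 < R.clock W p.2 (n + 1)} ∩ ({p | p.2.1 n ∈ Z} ∩
      ⋂ k, ⋂ (_ : k ≤ n), {p | p.2.1 k ∈ Wᶜ ∪ S}))) := by
    ext p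
    simp [stayEvent, imp_iff_not_or]
  rw [this]
  exact MeasurableSet.iUnion fun n => (measurableSet_le (hc n) ht).inter
    ((measurableSet_lt ht (hc _)).inter ((hY n Z).inter
      (MeasurableSet.iInter fun k => MeasurableSet.iInter fun _ => hY k _)))

lemma measurableSet_stayEvent (R : JumpRates E) (W S Z : Set E) (t : ℝ) :
    MeasurableSet (R.stayEvent W S Z t) :=
  measurable_prodMk_left (R.measurableSet_stayEvent_prod W S Z)

lemma measurable_stayProb (R : JumpRates E) (W S Z : Set E) (η : E) :
    Measurable fun t => R.stayProb W S Z t η :=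
  (measurable_measure_prodMk_left (R.measurableSet_stayEvent_prod W S Z)).ennreal_toReal

lemma stayProb_nonneg (R : JumpRates E) (W S Z : Set E) (t : ℝ) (η : E) :
    0 ≤ R.stayProb W S Z t η := measureReal_nonneg

lemma stayProb_le_one (R : JumpRates E) (W S Z : Set E) (t : ℝ) (η : E) :
    R.stayProb W S Z t η ≤ 1 := measureReal_le_one

/-- The Markov property at the first jump, for the probabilities of events. -/
lemma law_real_eq_integral (R : JumpRates E) {η : E} (h : R.holdingRate η ≠ 0)
    {Γ : Set (Sample E)} (hΓ : MeasurableSet Γ) :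
    (R.law η).real Γ = ∫ s, ∑ ζ, R.prob η ζ *
      (R.law ζ).real {ω | ((seqCons η ω.1, seqCons s ω.2) : Sample E) ∈ Γ} ∂(expMeasure 1) := by
  have hmeas : ∀ ζ, Measurable fun s =>
      R.law ζ {ω | ((seqCons η ω.1, seqCons s ω.2) : Sample E) ∈ Γ} := by
    intro ζ
    have : MeasurableSet {p : ℝ × Sample E |
        ((seqCons η p.2.1, seqCons p.1 p.2.2) : Sample E) ∈ Γ} := by
      refine Measurable.prodMk ?_ ?_ hΓ
      · exact measurable_seqCons.comp
          (measurable_const.prodMk (measurable_fst.comp measurable_snd))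
      · exact measurable_seqCons.comp
          (measurable_fst.prodMk (measurable_snd.comp measurable_snd))
    exact measurable_measure_prodMk_left this
  rw [measureReal_def, law_apply_eq_lintegral R η hΓ, ← integral_toReal]
  · refine integral_congr_ae (ae_of_all _ fun s => ?_)
    simp only
    rw [ENNReal.toReal_sum]
    · refine Finset.sum_congr rfl fun ζ _ => ?_
      rw [ENNReal.toReal_mul, toReal_jumpPMF R h, measureReal_def]
    · exact fun ζ _ => ENNReal.mul_ne_top (PMF.apply_ne_top _ _) (measure_ne_top _ _)
  · exact (Finset.measurable_fun_sum _ fun ζ _ => (hmeas ζ).const_mul _).aemeasurable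
  · exact ae_of_all _ fun s => ENNReal.sum_lt_top.2 fun ζ _ =>
      ENNReal.mul_lt_top (PMF.apply_lt_top _ _) (measure_lt_top _ _)

/-- The clock of the trace does not run outside W, so the first jump costs no time: as a function of
the starting point, the probability is harmonic off W. -/
lemma stayProb_of_notMem (R : JumpRates E) {W S Z : Set E} {η : E} (h : R.holdingRate η ≠ 0)
    (hη : η ∉ W) (t : ℝ) :
    R.stayProb W S Z t η = ∑ ζ, R.prob η ζ * R.stayProb W S Z t ζ := by
  unfold stayProb
  rw [law_real_eq_integral R h (R.measurableSet_stayEvent W S Z t)]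
  have : ∀ s : ℝ, {ω : Sample E | ((seqCons η ω.1, seqCons s ω.2) : Sample E) ∈
      R.stayEvent W S Z t} = R.stayEvent W S Z t := by
    intro s
    ext ω
    simp only [stayEvent, Set.mem_ofPred_eq]
    constructor
    · rintro ⟨n, h1, h2, h3, h4⟩
      cases n with
      | zero => simp [clock_cons_succ, clock_zero, hη] at h2
      | succ n =>
        simp only [clock_cons_succ, Set.indicator_of_notMem hη, zero_add, seqCons_succ] at h1 h2 h3
        exact ⟨n, h1, h2, h3, fun k hk => h4 (k + 1) (by omega)⟩
    · rintro ⟨n, h1, h2, h3, h4⟩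
      refine ⟨n + 1, ?_, ?_, h3, ?_⟩
      · simpa [clock_cons_succ, hη] using h1
      · simpa [clock_cons_succ, hη] using h2
      · intro k hk hkW
        cases k with
        | zero => exact absurd hkW hη
        | succ k => exact h4 k (by omega) hkW
  simp [this]

/-- The chain starts from its initial configuration. -/
lemma ae_zero_eq (R : JumpRates E) (η : E) : ∀ᵐ ω ∂(R.law η), ω.1 0 = η := by
  have hm : MeasurableSet {ω : Sample E | ¬ ω.1 0 = η} :=
    (measurableSet_eq_fun ((measurable_pi_apply 0).comp measurable_fst) measurable_const).compl
  rw [ae_iff, law_apply_eq_lintegral R η hm]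
  simp

lemma stayProb_of_mem_of_notMem (R : JumpRates E) {W S Z : Set E} {η : E}
    (hη : η ∈ W) (hηS : η ∉ S) (t : ℝ) : R.stayProb W S Z t η = 0 := by
  unfold stayProb
  rw [measureReal_def, ENNReal.toReal_eq_zero_iff]
  left
  refine measure_mono_null ?_ (ae_iff.1 (R.ae_zero_eq η))
  rintro ω ⟨n, -, -, -, h4⟩ h0
  have := h4 0 (Nat.zero_le n)
  simp only [h0] at this
  exact hηS (this hη)

open scoped Classical in
/-- The renewal equation of the trace process killed when it leaves `S`. -/
lemma stayProb_of_mem (R : JumpRates E) {W S Z : Set E} (hSW : S ⊆ W) {η : E}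
    (h : R.holdingRate η ≠ 0) (hη : η ∈ S) {t : ℝ} (ht : 0 ≤ t) :
    R.stayProb W S Z t η = Real.exp (-(R.holdingRate η * t)) *
      ((if η ∈ Z then 1 else 0) + R.holdingRate η *
        ∫ r in (0 : ℝ)..t, Real.exp (R.holdingRate η * r) *
          ∑ ζ, R.prob η ζ * R.stayProb W S Z r ζ) := by
  have hl : 0 < (R.holdingRate η : ℝ) := by
    exact_mod_cast pos_iff_ne_zero.2 h
  have hbd : ∀ r, |∑ ζ, R.prob η ζ * R.stayProb W S Z r ζ| ≤ 1 := by
    intro r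
    rw [abs_of_nonneg (Finset.sum_nonneg fun ζ _ =>
      mul_nonneg (R.prob_nonneg _ _) (R.stayProb_nonneg _ _ _ _ _)), ← R.sum_prob h]
    exact Finset.sum_le_sum fun ζ _ =>
      mul_le_of_le_one_right (R.prob_nonneg _ _) (R.stayProb_le_one _ _ _ _ _)
  rw [← integral_expMeasure_split hl ht
    (Finset.measurable_fun_sum _ fun ζ _ => (R.measurable_stayProb W S Z ζ).const_mul _) hbd]
  unfold stayProb
  rw [law_real_eq_integral R h (R.measurableSet_stayEvent W S Z t), integral_expMeasure_one,
    integral_expMeasure_one]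
  refine setIntegral_congr_fun measurableSet_Ioi fun s hs => ?_
  have hs : 0 < s := hs
  congr 1
  have hW : η ∈ W := hSW hη
  have hJ : ENNReal.ofReal s / (R.holdingRate η : ℝ≥0∞) =
      ENNReal.ofReal (s / R.holdingRate η) := by
    rw [ENNReal.ofReal_div_of_pos hl, ENNReal.ofReal_coe_nnreal]
  split_ifs with h1 h2
  · have : ∀ ζ : E, (R.law ζ).real {ω : Sample E |
        ((seqCons η ω.1, seqCons s ω.2) : Sample E) ∈ R.stayEvent W S Z t} = 1 := by
      intro ζ
      have : {ω : Sample E | ((seqCons η ω.1, seqCons s ω.2) : Sample E) ∈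
          R.stayEvent W S Z t} = Set.univ := by
        refine Set.eq_univ_of_forall fun ω => ⟨0, ?_, ?_, h2, ?_⟩
        · simp [clock_zero]
        · rw [clock_cons_succ, Set.indicator_of_mem hW, clock_zero, add_zero, hJ]
          exact (ENNReal.ofReal_lt_ofReal_iff (by positivity)).2 h1
        · intro k hk _
          obtain rfl : k = 0 := by omega
          exact hη
      rw [this, probReal_univ]
    simp [this, R.sum_prob h]
  · have : ∀ ζ : E, (R.law ζ).real {ω : Sample E |
        ((seqCons η ω.1, seqCons s ω.2) : Sample E) ∈ R.stayEvent W S Z t} = 0 := by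
      intro ζ
      have : {ω : Sample E | ((seqCons η ω.1, seqCons s ω.2) : Sample E) ∈
          R.stayEvent W S Z t} = ∅ := by
        refine Set.eq_empty_of_forall_notMem ?_
        rintro ω ⟨n, h3, -, h4, -⟩
        cases n with
        | zero => exact h2 h4
        | succ n =>
          rw [clock_cons_succ, Set.indicator_of_mem hW, hJ] at h3
          refine absurd (le_self_add.trans h3) (not_le.2 ?_)
          exact (ENNReal.ofReal_lt_ofReal_iff (by positivity)).2 h1
      rw [this, measureReal_empty]
    simp [this]
  -- The jump has taken place by time t: the process starts afresh with the time t - s / λ(η) left.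
  -- The subtraction is made explicit as a sum in `ℝ≥0∞` in order to cancel the first holding time.
  · have hst : s / R.holdingRate η ≤ t := not_lt.1 h1
    have htt : ENNReal.ofReal t = ENNReal.ofReal (s / R.holdingRate η) +
        ENNReal.ofReal (t - s / R.holdingRate η) := by
      rw [← ENNReal.ofReal_add (by positivity) (by linarith)]
      congr 1
      ring
    have : {ω : Sample E | ((seqCons η ω.1, seqCons s ω.2) : Sample E) ∈
        R.stayEvent W S Z t} = R.stayEvent W S Z (t - s / R.holdingRate η) := by
      ext ω
      simp only [stayEvent, Set.mem_ofPred_eq]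
      constructor
      · rintro ⟨n, h1, h2, h3, h4⟩
        cases n with
        | zero =>
          rw [clock_cons_succ, Set.indicator_of_mem hW, clock_zero, add_zero, hJ] at h2
          exact absurd h2 (not_lt.2 (ENNReal.ofReal_le_ofReal hst))
        | succ n =>
          rw [clock_cons_succ, Set.indicator_of_mem hW, hJ, htt,
            ENNReal.add_le_add_iff_left ENNReal.ofReal_ne_top] at h1
          rw [clock_cons_succ, Set.indicator_of_mem hW, hJ, htt,
            ENNReal.add_lt_add_iff_left ENNReal.ofReal_ne_top] at h2
          exact ⟨n, h1, h2, h3, fun k hk => h4 (k + 1) (by omega)⟩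
      · rintro ⟨n, h1, h2, h3, h4⟩
        refine ⟨n + 1, ?_, ?_, h3, ?_⟩
        · rwa [clock_cons_succ, Set.indicator_of_mem hW, hJ, htt,
            ENNReal.add_le_add_iff_left ENNReal.ofReal_ne_top]
        · rwa [clock_cons_succ, Set.indicator_of_mem hW, hJ, htt,
            ENNReal.add_lt_add_iff_left ENNReal.ofReal_ne_top]
        · intro k hk hkW
          cases k with
          | zero => exact hη
          | succ k => exact h4 k (by omega) hkW
    rw [this]

end JumpRates

/-! ## Harmonic functions of a finite irreducible transition matrix -/

section Potential

variable {E : Type*} [Fintype E]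

/-- The mean `∑ ζ, p η ζ * g ζ` of `g` after one step from `η`. -/
def avg (p : E → E → ℝ) : (E → ℝ) →ₗ[ℝ] (E → ℝ) where
  toFun g η := ∑ ζ, p η ζ * g ζ
  map_add' f g := by ext η; simp [mul_add, Finset.sum_add_distrib]
  map_smul' c g := by ext η; simp [Finset.mul_sum, mul_left_comm]

lemma avg_apply (p : E → E → ℝ) (g : E → ℝ) (η : E) : avg p g η = ∑ ζ, p η ζ * g ζ := rfl

/-- A transition matrix which is irreducible. -/
structure IsIrredStochastic (p : E → E → ℝ) : Prop where
  nonneg : ∀ η ζ, 0 ≤ p η ζ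
  sum_eq_one : ∀ η, ∑ ζ, p η ζ = 1
  irred : ∀ η ζ, Relation.ReflTransGen (fun a b => 0 < p a b) η ζ

variable {p : E → E → ℝ}

lemma IsIrredStochastic.avg_const (hp : IsIrredStochastic p) (c : ℝ) (η : E) :
    avg p (fun _ => c) η = c := by
  rw [avg_apply, ← Finset.sum_mul, hp.sum_eq_one, one_mul]

/-- The maximum principle. -/
lemma IsIrredStochastic.nonpos_of_subharmonic (hp : IsIrredStochastic p) {V : Set E}
    (hV : V.Nonempty) {g : E → ℝ} (h1 : ∀ η ∈ V, g η ≤ 0) (h2 : ∀ η ∉ V, g η ≤ avg p g η)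
    (η : E) : g η ≤ 0 := by
  obtain ⟨v, hv⟩ := hV
  obtain ⟨m, -, hm⟩ := Finset.exists_max_image Finset.univ g ⟨v, Finset.mem_univ v⟩
  have hm : ∀ ζ, g ζ ≤ g m := fun ζ => hm ζ (Finset.mem_univ ζ)
  refine (hm η).trans ?_
  by_contra! hpos
  -- A positive maximum is not attained on V, and where it is attained off V it must also be
  -- attained at every neighbour. By irreducibility it would propagate to V.
  have : ∀ ζ, Relation.ReflTransGen (fun a b => 0 < p a b) m ζ → g ζ = g m := by
    intro ζ h
    induction h with
    | refl => rfl
    | @tail a b _ hab ih =>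
      have ha : a ∉ V := fun haV => by have := h1 a haV; linarith
      have h3 := h2 a ha
      rw [avg_apply, ih] at h3
      have h4 : ∑ ζ, p a ζ * (g m - g ζ) ≤ 0 := by
        simp only [mul_sub, Finset.sum_sub_distrib, ← Finset.sum_mul, hp.sum_eq_one]
        linarith
      have h5 : p a b * (g m - g b) ≤ 0 :=
        (Finset.single_le_sum (f := fun ζ => p a ζ * (g m - g ζ))
          (fun ζ _ => mul_nonneg (hp.nonneg _ _) (sub_nonneg.2 (hm ζ)))
          (Finset.mem_univ b)).trans h4
      have h6 : g m - g b ≤ 0 := nonpos_of_mul_nonpos_right h5 hab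
      exact le_antisymm (hm b) (by linarith)
  have h := this v (hp.irred m v)
  have := h1 v hv
  linarith

lemma IsIrredStochastic.nonneg_of_superharmonic (hp : IsIrredStochastic p) {V : Set E}
    (hV : V.Nonempty) {g : E → ℝ} (h1 : ∀ η ∈ V, 0 ≤ g η) (h2 : ∀ η ∉ V, avg p g η ≤ g η)
    (η : E) : 0 ≤ g η := by
  have := hp.nonpos_of_subharmonic hV (g := -g) (fun η hη => by simpa using h1 η hη)
    (fun η hη => by rw [map_neg]; simpa using h2 η hη) η
  simpa using this

/-- Two solutions of the same Dirichlet problem are equal. -/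
lemma IsIrredStochastic.eq_of_dirichlet (hp : IsIrredStochastic p) {V : Set E}
    (hV : V.Nonempty) {f g : E → ℝ} (h1 : ∀ η ∈ V, f η = g η)
    (h2 : ∀ η ∉ V, f η - avg p f η = g η - avg p g η) : f = g := by
  have h3 : ∀ η ∉ V, (f - g) η = avg p (f - g) η := fun η hη => by
    rw [map_sub]
    simp only [Pi.sub_apply]
    linarith [h2 η hη]
  ext η
  have ha := hp.nonpos_of_subharmonic hV (g := f - g) (fun η hη => by simp [h1 η hη])
    (fun η hη => (h3 η hη).le) η
  have hb := hp.nonneg_of_superharmonic hV (g := f - g) (fun η hη => by simp [h1 η hη])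
    (fun η hη => (h3 η hη).ge) η
  exact sub_eq_zero.1 (le_antisymm ha hb)

/-- The Dirichlet problem has a solution, which depends linearly on the data. -/
lemma IsIrredStochastic.exists_dirichlet (hp : IsIrredStochastic p) {V : Set E}
    (hV : V.Nonempty) : ∃ G : (E → ℝ) →ₗ[ℝ] (E → ℝ), ∀ b, (∀ η ∈ V, G b η = b η) ∧
      ∀ η ∉ V, G b η - avg p (G b) η = b η := by
  classical
  -- The operator of the Dirichlet problem. Uniqueness says that it is injective, hence bijective in
  -- finite dimension.
  let T : (E → ℝ) →ₗ[ℝ] (E → ℝ) :=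
    { toFun := fun g η => if η ∈ V then g η else g η - avg p g η
      map_add' := fun f g => by
        ext η
        simp only [map_add, Pi.add_apply]
        split_ifs <;> ring
      map_smul' := fun c g => by
        ext η
        simp only [map_smul, Pi.smul_apply, smul_eq_mul, RingHom.id_apply]
        split_ifs <;> ring }
  have hT : ∀ g η, T g η = if η ∈ V then g η else g η - avg p g η := fun g η => rfl
  have hinj : Function.Injective T := by
    intro f g hfg
    refine hp.eq_of_dirichlet hV (fun η hη => ?_) (fun η hη => ?_)
    · simpa [hT, hη] using congrFun hfg η
    · simpa [hT, hη] using congrFun hfg η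
  let e := LinearEquiv.ofInjectiveEndo T hinj
  refine ⟨e.symm.toLinearMap, fun b => ?_⟩
  have h : T (e.symm b) = b := e.apply_symm_apply b
  refine ⟨fun η hη => ?_, fun η hη => ?_⟩
  · simpa [hT, hη] using congrFun h η
  · simpa [hT, hη] using congrFun h η

/-- `H f` is the function equal to `f` on `V` and harmonic outside of `V`. -/
def IsHarmonicExt (p : E → E → ℝ) (V : Set E) (H : (E → ℝ) →ₗ[ℝ] (E → ℝ)) : Prop :=
  ∀ f, (∀ η ∈ V, H f η = f η) ∧ ∀ η ∉ V, H f η = avg p (H f) η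

lemma IsIrredStochastic.exists_isHarmonicExt (hp : IsIrredStochastic p) {V : Set E}
    (hV : V.Nonempty) : ∃ H, IsHarmonicExt p V H := by
  classical
  obtain ⟨G, hG⟩ := hp.exists_dirichlet hV
  let I : (E → ℝ) →ₗ[ℝ] (E → ℝ) :=
    { toFun := fun f => V.indicator f
      map_add' := fun f g => Set.indicator_add _ _ _
      map_smul' := fun c g => by ext η; by_cases h : η ∈ V <;> simp [h] }
  have hI : ∀ f, I f = V.indicator f := fun f => rfl
  refine ⟨G ∘ₗ I, fun f => ⟨fun η hη => ?_, fun η hη => ?_⟩⟩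
  · rw [LinearMap.comp_apply, (hG _).1 η hη, hI, Set.indicator_of_mem hη]
  · have := (hG (I f)).2 η hη
    rw [hI, Set.indicator_of_notMem hη] at this
    rw [LinearMap.comp_apply, hI]
    linarith

lemma IsHarmonicExt.eq_of_harmonic {V : Set E} {H : (E → ℝ) →ₗ[ℝ] (E → ℝ)}
    (hH : IsHarmonicExt p V H) (hp : IsIrredStochastic p) (hV : V.Nonempty) {f g : E → ℝ}
    (h1 : ∀ η ∈ V, g η = f η) (h2 : ∀ η ∉ V, g η = avg p g η) : H f = g := by
  refine hp.eq_of_dirichlet hV (fun η hη => ?_) (fun η hη => ?_)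
  · rw [(hH f).1 η hη, h1 η hη]
  · linarith [(hH f).2 η hη, h2 η hη]

end Potential

/-! ## The generator of the trace process -/

section Generator

variable {E : Type*} [Fintype E]

open scoped Classical in
/-- The operator `f ↦ 1_S l (p H (1_S f) - f)`. When `H` is the harmonic extension from `V ⊇ S`,
it is the generator of the trace on `V` of the chain with holding rates `l` and jump matrix `p`,
killed when it leaves `S`. -/
def killedGen (p : E → E → ℝ) (l : E → ℝ) (H : (E → ℝ) →ₗ[ℝ] (E → ℝ)) (S : Set E) :
    (E → ℝ) →L[ℝ] (E → ℝ) :=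
  LinearMap.toContinuousLinearMap
    { toFun := fun f η => if η ∈ S then l η * (avg p (H (S.indicator f)) η - f η) else 0
      map_add' := fun f g => by
        ext η
        rw [Set.indicator_add']
        simp only [map_add, Pi.add_apply]
        split_ifs <;> ring
      map_smul' := fun c g => by
        ext η
        have : S.indicator (c • g) = c • S.indicator g := by
          ext η; by_cases h : η ∈ S <;> simp [h]
        rw [this]
        simp only [map_smul, Pi.smul_apply, smul_eq_mul, RingHom.id_apply]
        split_ifs <;> ring }

variable {p : E → E → ℝ} {l : E → ℝ} {H : (E → ℝ) →ₗ[ℝ] (E → ℝ)} {S : Set E}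

lemma killedGen_apply_mem {η : E} (hη : η ∈ S) (f : E → ℝ) :
    killedGen p l H S f η = l η * (avg p (H (S.indicator f)) η - f η) :=
  if_pos hη

lemma killedGen_apply_notMem {η : E} (hη : η ∉ S) (f : E → ℝ) : killedGen p l H S f η = 0 :=
  if_neg hη

/-- The semigroup of operators with generator `A`. -/
def semigroup (A : (E → ℝ) →L[ℝ] (E → ℝ)) (t : ℝ) : (E → ℝ) →L[ℝ] (E → ℝ) :=
  NormedSpace.exp (t • A)

lemma semigroup_zero (A : (E → ℝ) →L[ℝ] (E → ℝ)) : semigroup A 0 = 1 := by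
  simp [semigroup]

lemma semigroup_add (A : (E → ℝ) →L[ℝ] (E → ℝ)) (s t : ℝ) (f : E → ℝ) :
    semigroup A (s + t) f = semigroup A s (semigroup A t f) := by
  let _ : NormedAlgebra ℚ ((E → ℝ) →L[ℝ] (E → ℝ)) := NormedAlgebra.restrictScalars ℚ ℝ _
  unfold semigroup
  rw [add_smul, NormedSpace.exp_add_of_commute]
  · rfl
  · exact ((Commute.refl A).smul_left s).smul_right t

lemma hasDerivAt_semigroup (A : (E → ℝ) →L[ℝ] (E → ℝ)) (t : ℝ) (f : E → ℝ) :
    HasDerivAt (fun s => semigroup A s f) (semigroup A t (A f)) t := by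
  have := (hasDerivAt_exp_smul_const (𝕂 := ℝ) A t).clm_apply (hasDerivAt_const t f)
  simpa [semigroup] using this

lemma hasDerivAt_semigroup' (A : (E → ℝ) →L[ℝ] (E → ℝ)) (t : ℝ) (f : E → ℝ) :
    HasDerivAt (fun s => semigroup A s f) (A (semigroup A t f)) t := by
  have := (hasDerivAt_exp_smul_const' (𝕂 := ℝ) A t).clm_apply (hasDerivAt_const t f)
  simpa [semigroup] using this

lemma semigroup_apply_of_gen_eq_zero (A : (E → ℝ) →L[ℝ] (E → ℝ)) {f : E → ℝ} (hf : A f = 0)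
    (t : ℝ) : semigroup A t f = f := by
  have h : ∀ s, HasDerivAt (fun s => semigroup A s f) 0 s := fun s => by
    simpa [hf] using hasDerivAt_semigroup A s f
  have := is_const_of_deriv_eq_zero (fun s => (h s).differentiableAt) (fun s => (h s).deriv) t 0
  simpa [semigroup_zero] using this

/-- A linear functional which vanishes on the range of the generator is invariant. -/
lemma map_semigroup_of_map_gen_eq_zero (A : (E → ℝ) →L[ℝ] (E → ℝ)) (φ : (E → ℝ) →L[ℝ] ℝ)
    (hφ : ∀ f, φ (A f) = 0) (t : ℝ) (f : E → ℝ) : φ (semigroup A t f) = φ f := by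
  have h : ∀ s, HasDerivAt (fun s => φ (semigroup A s f)) 0 s := fun s => by
    have h1 := φ.hasFDerivAt.comp_hasDerivAt s (hasDerivAt_semigroup' A s f)
    rw [hφ] at h1
    exact h1
  have := is_const_of_deriv_eq_zero (fun s => (h s).differentiableAt) (fun s => (h s).deriv) t 0
  simpa [semigroup_zero] using this

/-- The generator vanishes at the points outside S, so the semigroup freezes the function there. It
represents the killed process only for functions that vanish outside S. -/
lemma semigroup_killedGen_apply_notMem {η : E} (hη : η ∉ S) (f : E → ℝ) (t : ℝ) :
    semigroup (killedGen p l H S) t f η = f η :=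
  map_semigroup_of_map_gen_eq_zero _ (ContinuousLinearMap.proj η)
    (fun f => killedGen_apply_notMem hη f) t f

/-- The semigroup of an operator which is symmetric for a bilinear form is symmetric. -/
lemma semigroup_symm (A : (E → ℝ) →L[ℝ] (E → ℝ)) (m : E → ℝ)
    (hA : ∀ f g : E → ℝ, ∑ η, m η * (A f η * g η) = ∑ η, m η * (f η * A g η))
    (t : ℝ) (f g : E → ℝ) :
    ∑ η, m η * (semigroup A t f η * g η) = ∑ η, m η * (f η * semigroup A t g η) := by
  -- Interpolation between the two sides: the pairing of the semigroup at s applied to f with the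
  -- semigroup at t - s applied to g is constant in s.
  have h : ∀ s, HasDerivAt
      (fun s => ∑ η, m η * (semigroup A s f η * semigroup A (t - s) g η)) 0 s := by
    intro s
    have h1 : ∀ η, HasDerivAt (fun s => semigroup A s f η) (A (semigroup A s f) η) s :=
      fun η => (hasDerivAt_pi.1 (hasDerivAt_semigroup' A s f)) η
    have h2 : ∀ η, HasDerivAt (fun s => semigroup A (t - s) g η)
        (-(A (semigroup A (t - s) g) η)) s := fun η => by
      have := (hasDerivAt_pi.1 (hasDerivAt_semigroup' A (t - s) g)) η
      simpa using this.comp_const_sub t s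
    have h3 := HasDerivAt.fun_sum (u := Finset.univ)
      fun η _ => (((h1 η).mul (h2 η)).const_mul (m η))
    refine HasDerivAt.congr_deriv h3 ?_
    simp only [mul_add, Finset.sum_add_distrib]
    rw [hA]
    simp
  have := is_const_of_deriv_eq_zero (fun s => (h s).differentiableAt) (fun s => (h s).deriv) t 0
  simpa [semigroup_zero] using this

end Generator

/-! ## The trace process and its semigroup -/

namespace JumpRates

variable {E : Type*} [Fintype E]

lemma holdingRate_ne_zero [Nontrivial E] {R : JumpRates E} (hR : R.Irreducible) (η : E) :
    R.holdingRate η ≠ 0 := by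
  intro h
  obtain ⟨ζ, hζ⟩ := exists_ne η
  rcases Relation.ReflTransGen.cases_head (hR η ζ) with h1 | ⟨c, hc, -⟩
  · exact hζ h1.symm
  · have : R.rate η c = 0 := by
      have := (Finset.sum_eq_zero_iff (s := Finset.univ) (f := fun ζ => R.rate η ζ)).1 h
      exact this c (Finset.mem_univ c)
    exact hc.ne' this

lemma holdingRate_pos [Nontrivial E] {R : JumpRates E} (hR : R.Irreducible) (η : E) :
    0 < (R.holdingRate η : ℝ) := by
  exact_mod_cast pos_iff_ne_zero.2 (holdingRate_ne_zero hR η)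

lemma isIrredStochastic_prob [Nontrivial E] {R : JumpRates E} (hR : R.Irreducible) :
    IsIrredStochastic R.prob where
  nonneg := R.prob_nonneg
  sum_eq_one η := R.sum_prob (holdingRate_ne_zero hR η)
  irred η ζ := by
    have h : (fun a b => 0 < R.rate a b) ≤ fun a b => 0 < R.prob a b := fun a b hab =>
      div_pos (by exact_mod_cast hab) (holdingRate_pos hR a)
    exact Relation.ReflTransGen.mono h _ _ (hR η ζ)

/-- The generator of the trace on a set, killed when it leaves `S`. -/
abbrev traceGen (R : JumpRates E) (H : (E → ℝ) →ₗ[ℝ] (E → ℝ)) (S : Set E) :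
    (E → ℝ) →L[ℝ] (E → ℝ) :=
  killedGen R.prob (fun η => (R.holdingRate η : ℝ)) H S

variable [MeasurableSpace E] [MeasurableSingletonClass E]

/-- The killed trace process has the semigroup `exp (t A)`. -/
lemma stayProb_eq_semigroup [Nontrivial E] {R : JumpRates E} (hR : R.Irreducible)
    {W S Z : Set E} (hW : W.Nonempty) (hSW : S ⊆ W) (hZS : Z ⊆ S)
    {H : (E → ℝ) →ₗ[ℝ] (E → ℝ)} (hH : IsHarmonicExt R.prob W H) {t : ℝ} (ht : 0 ≤ t) {η : E}
    (hη : η ∈ S) :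
    R.stayProb W S Z t η = semigroup (R.traceGen H S) t (Z.indicator 1) η := by
  classical
  set A := R.traceGen H S with hA
  set u : ℝ → E → ℝ := fun t => R.stayProb W S Z t with hu
  have hl := holdingRate_ne_zero hR
  -- The values on S determine u(t) everywhere: it is 0 on W ∖ S and harmonic off W. This is how the
  -- harmonic extension enters the generator.
  have hext : ∀ t, H (S.indicator (u t)) = u t := fun t =>
    hH.eq_of_harmonic (isIrredStochastic_prob hR) hW
      (fun η hη => by
        by_cases hηS : η ∈ S
        · rw [Set.indicator_of_mem hηS]
        · rw [Set.indicator_of_notMem hηS]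
          exact R.stayProb_of_mem_of_notMem hη hηS t)
      (fun η hη => R.stayProb_of_notMem (hl η) hη t)
  -- The right side of the renewal equation. Unlike u, which is only known to be measurable, it is
  -- visibly continuous in time.
  let V : ℝ → E → ℝ := fun t η => if η ∈ S then Real.exp (-(R.holdingRate η * t)) *
      ((if η ∈ Z then 1 else 0) + R.holdingRate η *
        ∫ r in (0 : ℝ)..t, Real.exp (R.holdingRate η * r) * avg R.prob (u r) η) else 0
  have hVu : ∀ t, 0 ≤ t → V t = S.indicator (u t) := by
    intro t ht
    ext η
    by_cases hη : η ∈ S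
    · simp only [V, hη, if_true, Set.indicator_of_mem]
      exact (R.stayProb_of_mem hSW (hl η) hη ht).symm
    · simp [V, hη]
  have havgm : ∀ η, Measurable fun r => avg R.prob (u r) η := fun η =>
    Finset.measurable_fun_sum _ fun ζ _ => (R.measurable_stayProb W S Z ζ).const_mul _
  have havgb : ∀ η r, ‖avg R.prob (u r) η‖ ≤ 1 := by
    intro η r
    rw [avg_apply, Real.norm_eq_abs, abs_of_nonneg (Finset.sum_nonneg fun ζ _ =>
      mul_nonneg (R.prob_nonneg _ _) (R.stayProb_nonneg _ _ _ _ _)), ← R.sum_prob (hl η)]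
    exact Finset.sum_le_sum fun ζ _ =>
      mul_le_of_le_one_right (R.prob_nonneg _ _) (R.stayProb_le_one _ _ _ _ _)
  have hint : ∀ η a b, IntervalIntegrable
      (fun r => Real.exp (R.holdingRate η * r) * avg R.prob (u r) η) volume a b := by
    intro η a b
    have h1 : IntervalIntegrable (fun r : ℝ => Real.exp (R.holdingRate η * r)) volume a b :=
      Continuous.intervalIntegrable (by fun_prop) a b
    rw [intervalIntegrable_iff] at h1 ⊢
    exact Integrable.mul_bdd (c := 1) h1 (havgm η).aestronglyMeasurable
      (ae_of_all _ (havgb η))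
  have hVc : Continuous V := by
    refine continuous_pi fun η => ?_
    by_cases hη : η ∈ S
    · simp only [V, hη, if_true]
      have := intervalIntegral.continuous_primitive (hint η) 0
      fun_prop
    · simp only [V, hη, if_false]
      exact continuous_const
  have hHc : Continuous H := H.continuous_of_finiteDimensional
  have hac : Continuous (avg R.prob) := (avg R.prob).continuous_of_finiteDimensional
  have hVd : ∀ s, 0 ≤ s → HasDerivWithinAt V (A (V s)) (Set.Ici s) s := by
    intro s hs
    rw [hasDerivWithinAt_pi]
    intro η
    by_cases hη : η ∈ S
    · set L : ℝ := (R.holdingRate η : ℝ)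
      set I : ℝ → ℝ := fun t => ∫ r in (0 : ℝ)..t, Real.exp (L * r) * avg R.prob (u r) η
      -- Bootstrap: for r ≥ 0 one has u(r) = H V(r), and V is continuous, so the integrand is
      -- right-continuous and its primitive has a right derivative.
      have hcont : ContinuousWithinAt (fun r => Real.exp (L * r) * avg R.prob (u r) η)
          (Set.Ioi s) s := by
        have h1 : Continuous fun r => Real.exp (L * r) * avg R.prob (H (V r)) η := by
          have : Continuous fun r => avg R.prob (H (V r)) η :=
            (continuous_apply η).comp (hac.comp (hHc.comp hVc))
          fun_prop
        have heq : ∀ r, 0 ≤ r → Real.exp (L * r) * avg R.prob (u r) η =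
            Real.exp (L * r) * avg R.prob (H (V r)) η := fun r hr => by
          rw [hVu r hr, hext]
        exact (h1.continuousWithinAt).congr (fun r hr => heq r (hs.trans (le_of_lt hr)))
          (heq s hs)
      have hI : HasDerivWithinAt I (Real.exp (L * s) * avg R.prob (u s) η) (Set.Ici s) s := by
        refine intervalIntegral.integral_hasDerivWithinAt_right (hint η 0 s)
          (s := Set.Ici s) (t := Set.Ioi s) ?_ hcont
        have hm : Measurable fun r => Real.exp (L * r) * avg R.prob (u r) η :=
          Measurable.mul (by fun_prop) (havgm η)
        exact hm.stronglyMeasurable.stronglyMeasurableAtFilter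
      have hE : HasDerivWithinAt (fun t => Real.exp (-(L * t))) (Real.exp (-(L * s)) * (-(L * 1)))
          (Set.Ici s) s :=
        (((hasDerivAt_id s).const_mul L).neg.exp).hasDerivWithinAt
      have hmul := hE.mul ((hI.const_mul L).const_add (if η ∈ Z then (1 : ℝ) else 0))
      have hVη : (fun t => V t η) = (fun t => Real.exp (-(L * t))) * fun t =>
          (if η ∈ Z then (1 : ℝ) else 0) + L * I t := by
        ext t
        simp [V, hη, I, L]
      rw [hVη]
      refine HasDerivWithinAt.congr_deriv hmul ?_
      have hVs : V s η = Real.exp (-(L * s)) * ((if η ∈ Z then (1 : ℝ) else 0) + L * I s) :=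
        congrFun hVη s
      rw [hA, killedGen_apply_mem hη, hVs, hVu s hs, Set.indicator_indicator, Set.inter_self, hext]
      have hee : Real.exp (-(L * s)) * Real.exp (L * s) = 1 := by
        rw [← Real.exp_add]; simp
      linear_combination ((L * avg R.prob (u s) η)) * hee
    · have : (fun t => V t η) = fun _ => 0 := by ext t; simp [V, hη]
      rw [this, hA, killedGen_apply_notMem hη]
      exact hasDerivWithinAt_const _ _ _
  have hV0 : V 0 = Z.indicator 1 := by
    ext η
    by_cases hZ : η ∈ Z
    · simp [V, hZS hZ, hZ]
    · simp [V, hZ]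
  -- V and exp(tA) 1_Z solve the same linear equation with the same initial value.
  have hsol := ODE_solution_unique (v := fun _ => A) (f := V)
    (g := fun t => semigroup A t (Z.indicator 1)) (a := 0) (b := t)
    (K := ‖A‖₊) (fun _ => A.lipschitz) hVc.continuousOn
    (fun s hs => hVd s hs.1)
    (fun s _ => (hasDerivAt_semigroup' A s _).continuousAt.continuousWithinAt)
    (fun s _ => (hasDerivAt_semigroup' A s _).hasDerivWithinAt)
    (by rw [hV0, semigroup_zero]; rfl)
  have := congrFun (hsol (Set.right_mem_Icc.2 ht)) η
  simp only [hVu t ht, Set.indicator_of_mem hη] at this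
  exact this

end JumpRates

/-! ### Reading the trajectory and its trace from the jump chain. -/

lemma occupationTime_mono {E : Type*} (ξ : ℝ → E) (A : Set E) : Monotone (occupationTime ξ A) :=
  fun _ _ h => lintegral_mono_set fun _ hs => ⟨hs.1, hs.2.trans_le h⟩

lemma volume_ofReal_mem_Ico {a u : ℝ≥0∞} (hau : a ≤ u) (hu : u ≠ ⊤) :
    volume {s : ℝ | 0 ≤ s ∧ a ≤ ENNReal.ofReal s ∧ ENNReal.ofReal s < u} = u - a := by
  have ha : a ≠ ⊤ := ne_top_of_le_ne_top hu hau
  have : {s : ℝ | 0 ≤ s ∧ a ≤ ENNReal.ofReal s ∧ ENNReal.ofReal s < u} =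
      Set.Ico a.toReal u.toReal := by
    ext s
    simp only [Set.mem_ofPred_eq, Set.mem_Ico]
    constructor
    · rintro ⟨h0, h1, h2⟩
      exact ⟨(ENNReal.le_ofReal_iff_toReal_le ha h0).1 h1,
        (ENNReal.ofReal_lt_iff_lt_toReal h0 hu).1 h2⟩
    · rintro ⟨h1, h2⟩
      have h0 : 0 ≤ s := ENNReal.toReal_nonneg.trans h1
      exact ⟨h0, (ENNReal.le_ofReal_iff_toReal_le ha h0).2 h1,
        (ENNReal.ofReal_lt_iff_lt_toReal h0 hu).2 h2⟩
  rw [this, Real.volume_Ico, ENNReal.ofReal_sub _ ENNReal.toReal_nonneg,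
    ENNReal.ofReal_toReal hu, ENNReal.ofReal_toReal ha]

namespace JumpRates

section Path

variable {E : Type*} [Fintype E]

/-- The samples whose holding times are positive and along which the time spent in `W` and the total
time are infinite. -/
structure IsRegular (R : JumpRates E) (W : Set E) (ω : Sample E) : Prop where
  pos : ∀ k, 0 < ω.2 k
  exists_lt_jumpTime : ∀ t, ∃ n, ENNReal.ofReal t < R.jumpTime ω n
  exists_lt_clock : ∀ t, ∃ n, ENNReal.ofReal t < R.clock W ω n

lemma jumpTime_eq_clock (R : JumpRates E) (ω : Sample E) (n : ℕ) :
    R.jumpTime ω n = R.clock Set.univ ω n := by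
  simp [jumpTime, clock]

lemma jumpTime_succ (R : JumpRates E) (ω : Sample E) (n : ℕ) :
    R.jumpTime ω (n + 1) =
      R.jumpTime ω n + ENNReal.ofReal (ω.2 n) / (R.holdingRate (ω.1 n) : ℝ≥0∞) :=
  Finset.sum_range_succ _ _

lemma jumpTime_mono (R : JumpRates E) (ω : Sample E) : Monotone (R.jumpTime ω) :=
  monotone_nat_of_le_succ fun n => by rw [jumpTime_succ]; exact le_self_add

lemma exists_le_lt_of_exists_lt {f : ℕ → ℝ≥0∞} (h0 : f 0 = 0) {t : ℝ≥0∞} (h : ∃ n, t < f n) :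
    ∃ n, f n ≤ t ∧ t < f (n + 1) := by
  classical
  obtain ⟨m, hm⟩ : ∃ m, Nat.find h = m + 1 := by
    refine Nat.exists_eq_succ_of_ne_zero fun h1 => ?_
    have := Nat.find_spec h
    rw [h1, h0] at this
    exact not_lt_zero this
  refine ⟨m, not_lt.1 (Nat.find_min h (by omega)), ?_⟩
  rw [← hm]
  exact Nat.find_spec h

lemma chain_eq {R : JumpRates E} {ω : Sample E} {n : ℕ} {t : ℝ}
    (h1 : R.jumpTime ω n ≤ ENNReal.ofReal t) (h2 : ENNReal.ofReal t < R.jumpTime ω (n + 1)) :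
    R.chain ω t = ω.1 n := by
  unfold chain
  refine congrArg ω.1 ?_
  refine le_antisymm (Nat.sInf_le h2) (le_csInf ⟨n, h2⟩ fun m hm => ?_)
  by_contra! hlt
  exact not_lt.2 ((R.jumpTime_mono ω hlt).trans h1) hm

variable {R : JumpRates E} {W : Set E} {ω : Sample E}

lemma jumpTime_ne_top (hl : ∀ η, R.holdingRate η ≠ 0) (n : ℕ) : R.jumpTime ω n ≠ ⊤ :=
  ENNReal.sum_ne_top.2 fun k _ =>
    ENNReal.div_ne_top ENNReal.ofReal_ne_top (by exact_mod_cast hl (ω.1 k))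

lemma IsRegular.jumpTime_lt (h : R.IsRegular W ω) (hl : ∀ η, R.holdingRate η ≠ 0) (n : ℕ) :
    R.jumpTime ω n < R.jumpTime ω (n + 1) := by
  rw [jumpTime_succ]
  refine ENNReal.lt_add_right (jumpTime_ne_top hl n) (ENNReal.div_pos ?_ ENNReal.coe_ne_top).ne'
  exact (ENNReal.ofReal_pos.2 (h.pos n)).ne'

lemma IsRegular.exists_jumpTime (h : R.IsRegular W ω) (t : ℝ) :
    ∃ n, R.jumpTime ω n ≤ ENNReal.ofReal t ∧ ENNReal.ofReal t < R.jumpTime ω (n + 1) :=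
  exists_le_lt_of_exists_lt (by simp [jumpTime]) (h.exists_lt_jumpTime t)

lemma IsRegular.exists_clock (h : R.IsRegular W ω) (t : ℝ) :
    ∃ n, R.clock W ω n ≤ ENNReal.ofReal t ∧ ENNReal.ofReal t < R.clock W ω (n + 1) :=
  exists_le_lt_of_exists_lt (R.clock_zero W ω) (h.exists_lt_clock t)

lemma mem_of_clock_lt {n : ℕ} (h : R.clock W ω n < R.clock W ω (n + 1)) : ω.1 n ∈ W := by
  by_contra hn
  rw [clock_succ, Set.indicator_of_notMem hn, add_zero] at h
  exact lt_irrefl _ h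

/-- The occupation time increases linearly with the time spent at `ω.1 n`. -/
lemma occupationTime_eq_add {n : ℕ} {u : ℝ≥0∞}
    (h1 : R.jumpTime ω n ≤ u) (h2 : u ≤ R.jumpTime ω (n + 1)) (hu : u ≠ ⊤) :
    occupationTime (R.chain ω) W u = occupationTime (R.chain ω) W (R.jumpTime ω n) +
      W.indicator (fun _ => u - R.jumpTime ω n) (ω.1 n) := by
  unfold occupationTime
  set I : Set ℝ := {s : ℝ | 0 ≤ s ∧ R.jumpTime ω n ≤ ENNReal.ofReal s ∧ ENNReal.ofReal s < u}
    with hI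
  have hof : Measurable fun s : ℝ => ENNReal.ofReal s := measurable_id.ennreal_ofReal
  have hIm : MeasurableSet I := measurableSet_Ici.inter
    ((measurableSet_le measurable_const hof).inter (measurableSet_lt hof measurable_const))
  have hset : {s : ℝ | 0 ≤ s ∧ ENNReal.ofReal s < u} =
      {s : ℝ | 0 ≤ s ∧ ENNReal.ofReal s < R.jumpTime ω n} ∪ I := by
    ext s
    simp only [hI, Set.mem_union, Set.mem_ofPred_eq]
    constructor
    · rintro ⟨h0, hs⟩
      rcases lt_or_ge (ENNReal.ofReal s) (R.jumpTime ω n) with h | h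
      · exact Or.inl ⟨h0, h⟩
      · exact Or.inr ⟨h0, h, hs⟩
    · rintro (⟨h0, hs⟩ | ⟨h0, -, hs⟩)
      · exact ⟨h0, hs.trans_le h1⟩
      · exact ⟨h0, hs⟩
  have hdisj : Disjoint {s : ℝ | 0 ≤ s ∧ ENNReal.ofReal s < R.jumpTime ω n} I :=
    Set.disjoint_left.2 fun s hs hs' => not_lt.2 hs'.2.1 hs.2
  rw [hset, lintegral_union hIm hdisj]
  congr 1
  have hc : ∀ s ∈ I, (R.chain ω ⁻¹' W).indicator (1 : ℝ → ℝ≥0∞) s =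
      W.indicator (fun _ => 1) (ω.1 n) := by
    intro s hs
    have := chain_eq hs.2.1 (hs.2.2.trans_le h2)
    by_cases hW : ω.1 n ∈ W
    · rw [Set.indicator_of_mem hW, Set.indicator_of_mem (by rwa [Set.mem_preimage, this])]
      rfl
    · rw [Set.indicator_of_notMem hW, Set.indicator_of_notMem (by rwa [Set.mem_preimage, this])]
  rw [setLIntegral_congr_fun hIm hc, setLIntegral_const, volume_ofReal_mem_Ico h1 hu]
  by_cases hW : ω.1 n ∈ W <;> simp [hW]

lemma occupationTime_jumpTime (hl : ∀ η, R.holdingRate η ≠ 0) (n : ℕ) :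
    occupationTime (R.chain ω) W (R.jumpTime ω n) = R.clock W ω n := by
  induction n with
  | zero => simp [jumpTime, clock, occupationTime]
  | succ n ih =>
    rw [occupationTime_eq_add (R.jumpTime_mono ω n.le_succ) le_rfl (jumpTime_ne_top hl _), ih,
      clock_succ]
    congr 1
    by_cases hW : ω.1 n ∈ W
    · rw [Set.indicator_of_mem hW, Set.indicator_of_mem hW, jumpTime_succ,
        ENNReal.add_sub_cancel_left (jumpTime_ne_top hl _)]
    · rw [Set.indicator_of_notMem hW, Set.indicator_of_notMem hW]

/-- The trace on `W` at time `t` is at the configuration visited when the time spent in `W`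
exceeds `t`. -/
lemma trace_eq (hl : ∀ η, R.holdingRate η ≠ 0) {n : ℕ} {t : ℝ}
    (h1 : R.clock W ω n ≤ ENNReal.ofReal t) (h2 : ENNReal.ofReal t < R.clock W ω (n + 1)) :
    trace (R.chain ω) W t = ω.1 n := by
  have hW : ω.1 n ∈ W := mem_of_clock_lt (h1.trans_lt h2)
  have hCtop : R.clock W ω n ≠ ⊤ := ne_top_of_le_ne_top ENNReal.ofReal_ne_top h1
  set J := R.jumpTime ω n with hJ
  have hJtop : J ≠ ⊤ := jumpTime_ne_top hl n
  -- The last instant at which the time spent in W is at most t: the clock runs at unit speed from J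
  -- onwards, since the n-th configuration is in W.
  set u := J + (ENNReal.ofReal t - R.clock W ω n) with hu
  have hutop : u ≠ ⊤ := ENNReal.add_ne_top.2 ⟨hJtop, ENNReal.sub_ne_top ENNReal.ofReal_ne_top⟩
  have hJu : J ≤ u := le_self_add
  have huJ : u < R.jumpTime ω (n + 1) := by
    rw [jumpTime_succ, hu, ENNReal.add_lt_add_iff_left hJtop]
    rw [clock_succ, Set.indicator_of_mem hW] at h2
    exact ENNReal.sub_lt_of_lt_add h1 (by rwa [add_comm])
  have hocc : ∀ v, J ≤ v → v ≤ R.jumpTime ω (n + 1) →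
      occupationTime (R.chain ω) W v = R.clock W ω n + (v - J) := by
    intro v hv1 hv2
    rw [occupationTime_eq_add hv1 hv2 (ne_top_of_le_ne_top (jumpTime_ne_top hl _) hv2),
      occupationTime_jumpTime hl, Set.indicator_of_mem hW]
  have hset : {s : ℝ | 0 ≤ s ∧ occupationTime (R.chain ω) W (ENNReal.ofReal s) ≤
      ENNReal.ofReal t} = Set.Icc 0 u.toReal := by
    ext s
    simp only [Set.mem_ofPred_eq, Set.mem_Icc, and_congr_right_iff]
    intro hs
    rw [← ENNReal.ofReal_le_iff_le_toReal hutop]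
    constructor
    · intro h
      by_contra! hlt
      -- A time after u is truncated at the next jump, where the linear formula `hocc` is still
      -- valid.
      set v := min (ENNReal.ofReal s) (R.jumpTime ω (n + 1))
      have huv : u < v := lt_min hlt huJ
      have hv := hocc v (hJu.trans huv.le) (min_le_right _ _)
      have hle : occupationTime (R.chain ω) W v ≤ ENNReal.ofReal t :=
        (occupationTime_mono _ _ (min_le_left _ _)).trans h
      rw [hv] at hle
      have h3 : v - J ≤ ENNReal.ofReal t - R.clock W ω n :=
        ENNReal.le_sub_of_add_le_left hCtop hle
      have h4 : v ≤ u := by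
        rw [hu]; exact tsub_le_iff_left.1 h3
      exact absurd huv (not_lt.2 h4)
    · intro h
      refine (occupationTime_mono _ _ h).trans ?_
      rw [hocc u hJu huJ.le, hu, ENNReal.add_sub_cancel_left hJtop, add_tsub_cancel_of_le h1]
  unfold trace occupationInverse
  rw [hset, csSup_Icc ENNReal.toReal_nonneg]
  refine chain_eq (n := n) ?_ ?_
  · rwa [ENNReal.ofReal_toReal hutop]
  · rwa [ENNReal.ofReal_toReal hutop]

/-- A time which precedes all those of a sojourn is at most its beginning. -/
lemma le_jumpTime_of_forall {a b I : ℝ≥0∞} (hab : a < b)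
    (h : ∀ t : ℝ, 0 < t → a < ENNReal.ofReal t → ENNReal.ofReal t < b → I ≤ ENNReal.ofReal t) :
    I ≤ a := by
  refine le_of_forall_gt_imp_ge_of_dense fun c hc => ?_
  obtain ⟨d, h1, h2⟩ := exists_between (lt_min hab hc)
  have hd : d ≠ ⊤ := (h2.trans_le (min_le_right _ _)).ne_top
  have h0 : 0 < d := zero_le.trans_lt h1
  have := h d.toReal (ENNReal.toReal_pos h0.ne' hd) (by rwa [ENNReal.ofReal_toReal hd])
    (by rw [ENNReal.ofReal_toReal hd]; exact h2.trans_le (min_le_left _ _))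
  rw [ENNReal.ofReal_toReal hd] at this
  exact this.trans (h2.le.trans (min_le_right _ _))

/-- The infimum defining the hitting time runs over t > 0, so the times just after the k-th jump are
used. They exist because holding times are positive, also when k = 0. -/
lemma IsRegular.hittingTime_le (h : R.IsRegular W ω) (hl : ∀ η, R.holdingRate η ≠ 0)
    {B : Set E} {k : ℕ} (hk : ω.1 k ∈ B) : hittingTime (R.chain ω) B ≤ R.jumpTime ω k := by
  refine le_jumpTime_of_forall (h.jumpTime_lt hl k) fun t ht h1 h2 => ?_
  refine iInf_le_of_le t (iInf_le_of_le ht (iInf_le_of_le ?_ le_rfl))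
  rwa [chain_eq h1.le h2]

/-- A visit to B before the clock passes δ would bound the trace hitting time by δ. Only this
inclusion is needed, as the hitting probability is to be bounded from above. -/
lemma IsRegular.mem_stayEvent_of_lt_traceHittingTime (h : R.IsRegular W ω)
    (hl : ∀ η, R.holdingRate η ≠ 0) {B : Set E} {δ : ℝ}
    (hδ : ENNReal.ofReal δ < traceHittingTime (R.chain ω) W B) :
    ω ∈ R.stayEvent W (W \ B) (W \ B) δ := by
  obtain ⟨n, h1, h2⟩ := h.exists_clock δ
  have hB : ∀ k ≤ n, ω.1 k ∉ B := by
    intro k hk hkB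
    refine absurd hδ (not_lt.2 ?_)
    unfold traceHittingTime
    refine (occupationTime_mono _ _ (h.hittingTime_le hl hkB)).trans ?_
    rw [occupationTime_jumpTime hl]
    exact (R.clock_mono W ω hk).trans h1
  exact ⟨n, h1, h2, ⟨mem_of_clock_lt (h1.trans_lt h2), hB n le_rfl⟩,
    fun k hk hkW => ⟨hkW, hB k hk⟩⟩

lemma IsRegular.trace_eq_iff (h : R.IsRegular W ω) (hl : ∀ η, R.holdingRate η ≠ 0) {t : ℝ}
    {ζ : E} : trace (R.chain ω) W t = ζ ↔ ω ∈ R.stayEvent W W {ζ} t := by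
  constructor
  · rintro rfl
    obtain ⟨n, h1, h2⟩ := h.exists_clock t
    exact ⟨n, h1, h2, (trace_eq hl h1 h2).symm, fun _ _ hk => hk⟩
  · rintro ⟨n, h1, h2, h3, -⟩
    rw [trace_eq hl h1 h2]
    exact h3

/-- If the chain hits `B` before it returns to its initial configuration `η`, then so does the jump
chain. -/
lemma IsRegular.exists_hit_of_lt_returnTime (h : R.IsRegular W ω)
    (hl : ∀ η, R.holdingRate η ≠ 0) {B : Set E} {η : E} (h0 : ω.1 0 = η)
    (h01 : ω.1 1 ≠ η)
    (hlt : hittingTime (R.chain ω) B < returnTime (R.chain ω) {η}) :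
    ∃ n, ω.1 n ∈ B ∧ ∀ k, 1 ≤ k → k ≤ n → ω.1 k ≠ η := by
  classical
  have hex : ∃ n, ω.1 n ∈ B := by
    by_contra! hn
    refine absurd hlt (not_lt.2 ?_)
    have : hittingTime (R.chain ω) B = ⊤ := by
      unfold hittingTime
      simp only [iInf_eq_top]
      intro t _ ht
      obtain ⟨n, h1, h2⟩ := h.exists_jumpTime t
      rw [chain_eq h1 h2] at ht
      exact absurd ht (hn n)
    rw [this]
    exact le_top
  -- At the first visit of the jump chain to B: a return to η at a step k ≥ 1 not later than it
  -- would make the return time at most the hitting time.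
  refine ⟨Nat.find hex, Nat.find_spec hex, fun k hk1 hk hkη => ?_⟩
  refine absurd hlt (not_lt.2 ?_)
  have hj : R.jumpTime ω (Nat.find hex) ≤ hittingTime (R.chain ω) B := by
    unfold hittingTime
    refine le_iInf fun t => le_iInf fun _ => le_iInf fun ht => ?_
    obtain ⟨n, h1, h2⟩ := h.exists_jumpTime t
    rw [chain_eq h1 h2] at ht
    exact (R.jumpTime_mono ω (Nat.find_min' hex ht)).trans h1
  refine le_trans ?_ ((R.jumpTime_mono ω hk).trans hj)
  -- The first jump is seen by the trajectory only because the jump chain really moves, Y 1 ≠ η.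
  -- Then all times after the k-th jump, k ≥ 1, count for the return.
  have hfirst : firstJumpTime (R.chain ω) ≤ R.jumpTime ω 1 := by
    refine le_jumpTime_of_forall (h.jumpTime_lt hl 1) fun t ht h1 h2 => ?_
    refine iInf_le_of_le t (iInf_le_of_le ht (iInf_le_of_le ?_ le_rfl))
    have hc0 : R.chain ω 0 = ω.1 0 := by
      refine chain_eq (by simp [jumpTime]) ?_
      refine lt_of_le_of_lt ?_ (h.jumpTime_lt hl 0)
      simp
    rw [chain_eq h1.le h2, hc0, h0]
    exact h01
  refine le_jumpTime_of_forall (h.jumpTime_lt hl k) fun t ht h1 h2 => ?_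
  refine iInf_le_of_le t (iInf_le_of_le ht (iInf_le_of_le ?_ (iInf_le_of_le ?_ le_rfl)))
  · exact (hfirst.trans (R.jumpTime_mono ω hk1)).trans_lt h1
  · rw [chain_eq h1.le h2]
    exact hkη

/-- Constants extend harmonically to constants: the trace is not killed when S = W, so its semigroup
preserves total mass. -/
lemma traceGen_indicator_self [Nontrivial E] (hR : R.Irreducible) (hW : W.Nonempty)
    {H : (E → ℝ) →ₗ[ℝ] (E → ℝ)} (hH : IsHarmonicExt R.prob W H) :
    R.traceGen H W (W.indicator 1) = 0 := by
  have hp := isIrredStochastic_prob hR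
  have h1 : H (W.indicator 1) = fun _ => 1 := by
    refine hH.eq_of_harmonic hp hW (fun η hη => by simp [hη]) fun η _ => ?_
    rw [hp.avg_const]
  ext η
  by_cases hη : η ∈ W
  · rw [killedGen_apply_mem hη, Set.indicator_indicator, Set.inter_self, h1, hp.avg_const]
    simp [hη]
  · rw [killedGen_apply_notMem hη]; rfl

end Path

/-! ## Almost sure properties -/

section AlmostSure

variable {E : Type*} [Fintype E] [MeasurableSpace E] [MeasurableSingletonClass E]
  {R : JumpRates E}

/-- This expresses that the clock of W almost surely passes t. It follows from the conservation of
mass by the trace semigroup on W, and off W from uniqueness in the Dirichlet problem. With W = E it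
is non-explosion. -/
lemma stayProb_self_eq_one [Nontrivial E] (hR : R.Irreducible) {W : Set E} (hW : W.Nonempty) {t : ℝ}
    (ht : 0 ≤ t) (η : E) : R.stayProb W W W t η = 1 := by
  have hp := isIrredStochastic_prob hR
  obtain ⟨H, hH⟩ := hp.exists_isHarmonicExt hW
  have hW1 : ∀ η ∈ W, R.stayProb W W W t η = 1 := by
    intro η hη
    rw [stayProb_eq_semigroup hR hW subset_rfl subset_rfl hH ht hη,
      semigroup_apply_of_gen_eq_zero _ (traceGen_indicator_self hR hW hH)]
    simp [hη]
  have := hp.eq_of_dirichlet hW (f := R.stayProb W W W t) (g := fun _ => 1) hW1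
    (fun η hη => by
      rw [hp.avg_const, R.stayProb_of_notMem (holdingRate_ne_zero hR η) hη]
      simp [avg_apply])
  rw [this]

lemma ae_exists_lt_clock [Nontrivial E] (hR : R.Irreducible) {W : Set E} (hW : W.Nonempty) (η : E) :
    ∀ᵐ ω ∂(R.law η), ∀ t : ℝ, ∃ n, ENNReal.ofReal t < R.clock W ω n := by
  have h : ∀ m : ℕ, ∀ᵐ ω ∂(R.law η), ω ∈ R.stayEvent W W W m := by
    intro m
    have := stayProb_self_eq_one hR hW (Nat.cast_nonneg m) η
    unfold stayProb at this
    rw [measureReal_def, ENNReal.toReal_eq_one_iff] at this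
    exact (mem_ae_iff_prob_eq_one (R.measurableSet_stayEvent W W W m)).2 this
  filter_upwards [ae_all_iff.2 h] with ω hω t
  obtain ⟨m, hm⟩ := exists_nat_ge t
  obtain ⟨n, -, h2, -⟩ := hω m
  exact ⟨n + 1, (ENNReal.ofReal_le_ofReal hm).trans_lt h2⟩

lemma ae_pos (R : JumpRates E) (η : E) : ∀ᵐ ω ∂(R.law η), ∀ k, 0 < ω.2 k := by
  refine ae_all_iff.2 fun k => ?_
  have h1 : ∀ᵐ s ∂(expMeasure 1), 0 < s := by
    have h : expMeasure 1 = volume.withDensity (exponentialPDF 1) := rfl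
    have hm : Measurable (exponentialPDF 1) :=
      (measurable_exponentialPDFReal 1).ennreal_ofReal
    rw [h, ae_withDensity_iff hm]
    filter_upwards [(measure_eq_zero_iff_ae_notMem.1 (measure_singleton (μ := volume) (0 : ℝ)))]
      with s hs0 hs
    by_contra! hle
    exact hs (exponentialPDF_of_neg (lt_of_le_of_ne hle hs0))
  have h2 : ∀ᵐ e ∂(Measure.infinitePi fun _ : ℕ => expMeasure 1), 0 < e k := by
    have := Measure.infinitePi_map_eval (fun _ : ℕ => expMeasure 1) k
    rw [← this] at h1
    exact ae_of_ae_map (measurable_pi_apply k).aemeasurable h1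
  unfold law
  exact Measure.quasiMeasurePreserving_snd.ae h2

lemma ae_isRegular [Nontrivial E] (hR : R.Irreducible) {W : Set E} (hW : W.Nonempty) (η : E) :
    ∀ᵐ ω ∂(R.law η), R.IsRegular W ω := by
  filter_upwards [R.ae_pos η, ae_exists_lt_clock hR hW η,
    ae_exists_lt_clock hR Set.univ_nonempty η] with ω h1 h2 h3
  refine ⟨h1, fun t => ?_, h2⟩
  obtain ⟨n, hn⟩ := h3 t
  exact ⟨n, by rwa [jumpTime_eq_clock]⟩

/-- There are no jumps from a point to itself, by `rate_self` and because no point is absorbing. -/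
lemma ae_one_ne [Nontrivial E] (hR : R.Irreducible) (η : E) : ∀ᵐ ω ∂(R.law η), ω.1 1 ≠ η := by
  have hm : MeasurableSet {ω : Sample E | ¬ ω.1 1 ≠ η} := by
    simp only [not_not]
    exact measurableSet_eq_fun ((measurable_pi_apply 1).comp measurable_fst) measurable_const
  have h0 : (R.law η).real {ω : Sample E | ¬ ω.1 1 ≠ η} = 0 := by
    rw [law_real_eq_integral R (holdingRate_ne_zero hR η) hm]
    have : ∀ ζ, R.prob η ζ * (R.law ζ).real {ω : Sample E | ω.1 0 = η} = 0 := by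
      intro ζ
      by_cases h : ζ = η
      · subst h
        simp [prob, R.rate_self]
      · have : R.law ζ {ω : Sample E | ω.1 0 = η} = 0 :=
          by
          refine measure_mono_null ?_ (ae_iff.1 (R.ae_zero_eq ζ))
          exact fun ω (h1 : ω.1 0 = η) (h2 : ω.1 0 = ζ) => h (h2.symm.trans h1)
        simp [measureReal_def, this]
    simp [this]
  rw [ae_iff]
  rwa [measureReal_eq_zero_iff] at h0

/-- The semigroup of the trace process. -/
lemma traceSemigroup_eq_stayProb [Nontrivial E] (hR : R.Irreducible) {W : Set E} (hW : W.Nonempty)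
    (t : ℝ) (η ζ : E) : R.traceSemigroup W t η ζ = R.stayProb W W {ζ} t η := by
  unfold traceSemigroup stayProb
  refine measureReal_congr ?_
  filter_upwards [ae_isRegular hR hW η] with ω hω
  exact propext (hω.trace_eq_iff (holdingRate_ne_zero hR))

lemma law_lt_traceHittingTime_le [Nontrivial E] (hR : R.Irreducible) {W : Set E} (hW : W.Nonempty)
    (B : Set E) (δ : ℝ) (η : E) :
    R.law η {ω | ENNReal.ofReal δ < traceHittingTime (R.chain ω) W B} ≤
      ENNReal.ofReal (R.stayProb W (W \ B) (W \ B) δ η) := by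
  unfold stayProb
  rw [ofReal_measureReal]
  refine measure_mono_ae ?_
  filter_upwards [ae_isRegular hR hW η] with ω hω h
  exact hω.mem_stayEvent_of_lt_traceHittingTime (holdingRate_ne_zero hR) h

/-- The event that the jump chain hits `B` without having visited `η`. -/
def hitEvent (B : Set E) (η : E) : Set (Sample E) :=
  {ω | ∃ n, ω.1 n ∈ B ∧ ∀ k ≤ n, ω.1 k ≠ η}

lemma measurableSet_hitEvent (B : Set E) (η : E) : MeasurableSet (hitEvent B η) := by
  have hY : ∀ k (A : Set E), MeasurableSet {ω : Sample E | ω.1 k ∈ A} := fun k A =>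
    ((measurable_pi_apply k).comp measurable_fst) (Set.toFinite A).measurableSet
  have : hitEvent B η = ⋃ n, ({ω : Sample E | ω.1 n ∈ B} ∩
      ⋂ k, ⋂ (_ : k ≤ n), {ω | ω.1 k ∈ ({η}ᶜ : Set E)}) := by
    ext ω
    simp [hitEvent]
  rw [this]
  exact MeasurableSet.iUnion fun n => (hY n B).inter
    (MeasurableSet.iInter fun k => MeasurableSet.iInter fun _ => hY k _)

/-- The probability that the chain hits `B` before `η`. -/
def hitProb (R : JumpRates E) (B : Set E) (η ζ : E) : ℝ := (R.law ζ).real (hitEvent B η)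

lemma hitProb_self (R : JumpRates E) (B : Set E) (η : E) : R.hitProb B η η = 0 := by
  unfold hitProb
  rw [measureReal_eq_zero_iff]
  refine measure_mono_null ?_ (ae_iff.1 (R.ae_zero_eq η))
  rintro ω ⟨n, -, h⟩ h0
  exact h 0 (Nat.zero_le n) h0

lemma hitProb_of_mem (R : JumpRates E) {B : Set E} {η ζ : E} (hη : η ∉ B) (hζ : ζ ∈ B) :
    R.hitProb B η ζ = 1 := by
  unfold hitProb
  rw [measureReal_def, ENNReal.toReal_eq_one_iff,
    ← mem_ae_iff_prob_eq_one (measurableSet_hitEvent B η)]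
  filter_upwards [R.ae_zero_eq ζ] with ω hω
  refine ⟨0, by rwa [hω], fun k hk => ?_⟩
  obtain rfl : k = 0 := by omega
  rw [hω]
  rintro rfl
  exact hη hζ

lemma hitProb_of_notMem [Nontrivial E] (hR : R.Irreducible) {B : Set E} {η ζ : E} (hζ : ζ ∉ B)
    (hne : ζ ≠ η) : R.hitProb B η ζ = avg R.prob (R.hitProb B η) ζ := by
  rw [avg_apply]
  unfold hitProb
  rw [law_real_eq_integral R (holdingRate_ne_zero hR ζ) (measurableSet_hitEvent B η)]
  have : ∀ s : ℝ, {ω : Sample E | ((seqCons ζ ω.1, seqCons s ω.2) : Sample E) ∈ hitEvent B η} =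
      hitEvent B η := by
    intro s
    ext ω
    constructor
    · rintro ⟨n, h1, h2⟩
      cases n with
      | zero => exact absurd h1 hζ
      | succ n => exact ⟨n, h1, fun k hk => h2 (k + 1) (by omega)⟩
    · rintro ⟨n, h1, h2⟩
      refine ⟨n + 1, h1, fun k hk => ?_⟩
      cases k with
      | zero => exact hne
      | succ k => exact h2 k (by omega)
  simp [this]

/-- The probability in the definition of the capacity is at most the probability that the jump chain
hits `B` before it returns to `η`. -/
lemma law_hittingTime_lt_returnTime_le [Nontrivial E] (hR : R.Irreducible) {B : Set E} {η : E}
    (hη : η ∉ B) :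
    R.law η {ω | hittingTime (R.chain ω) B < returnTime (R.chain ω) {η}} ≤
      ENNReal.ofReal (avg R.prob (R.hitProb B η) η) := by
  set Γ : Set (Sample E) := {ω | (fun n => ω.1 (n + 1), fun n => ω.2 (n + 1)) ∈ hitEvent B η}
    with hΓ
  have hm : MeasurableSet Γ := by
    refine Measurable.prodMk ?_ ?_ (measurableSet_hitEvent B η)
    · exact measurable_pi_lambda _ fun n => (measurable_pi_apply (n + 1)).comp measurable_fst
    · exact measurable_pi_lambda _ fun n => (measurable_pi_apply (n + 1)).comp measurable_snd
  have h1 : (R.law η).real Γ = avg R.prob (R.hitProb B η) η := by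
    rw [law_real_eq_integral R (holdingRate_ne_zero hR η) hm, avg_apply]
    have : ∀ s : ℝ, {ω : Sample E | ((seqCons η ω.1, seqCons s ω.2) : Sample E) ∈ Γ} =
        hitEvent B η := fun s => rfl
    simp [this, hitProb]
  rw [← h1, ofReal_measureReal]
  refine measure_mono_ae ?_
  filter_upwards [ae_isRegular hR Set.univ_nonempty η, R.ae_zero_eq η, ae_one_ne hR η]
    with ω hω h0 h01 h
  obtain ⟨n, h2, h3⟩ :=
    hω.exists_hit_of_lt_returnTime (holdingRate_ne_zero hR) h0 h01 h
  cases n with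
  | zero => exact absurd h2 (by rwa [h0])
  | succ n => exact ⟨n, h2, fun k hk => h3 (k + 1) (by omega) (by omega)⟩

end AlmostSure

end JumpRates

namespace JumpRates

/-! ## Bounds on the hitting time of the trace process -/

section MeanTime

variable {E : Type*} [Fintype E] {R : JumpRates E}

/-- Some point has positive mass, and the balance equation carries positivity along every jump of
positive rate. -/
lemma IsStationary.pos (hR : R.Irreducible) {μ : E → ℝ≥0} (hμ : R.IsStationary μ) (η : E) :
    0 < μ η := by
  have hstep : ∀ a b, 0 < μ a → 0 < R.rate a b → 0 < μ b := by
    intro a b ha hab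
    have h1 : 0 < ∑ η, μ η * R.rate η b :=
      (mul_pos ha hab).trans_le
        (Finset.single_le_sum (f := fun η => μ η * R.rate η b) (fun _ _ => zero_le)
          (Finset.mem_univ a))
    rw [hμ.balance b] at h1
    exact pos_of_mul_pos_left h1 zero_le
  obtain ⟨a, ha⟩ : ∃ a, 0 < μ a := by
    by_contra! h
    have h0 : ∑ η, μ η = 0 := Finset.sum_eq_zero fun η _ => le_antisymm (h η) zero_le
    rw [hμ.sum_eq_one] at h0
    exact one_ne_zero h0
  have := hR a η
  induction this with
  | refl => exact ha
  | tail _ hbc ih => exact hstep _ _ ih hbc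

variable [Nontrivial E] {W B : Set E} {H : (E → ℝ) →ₗ[ℝ] (E → ℝ)}

/-- The mean time spent in `W` before hitting `B` solves a Dirichlet problem. -/
structure IsMeanTime (R : JumpRates E) (W B : Set E) (g : E → ℝ) : Prop where
  eq_zero : ∀ η ∈ B, g η = 0
  sub_avg : ∀ η ∉ B, g η - avg R.prob g η = W.indicator (fun η => (R.holdingRate η : ℝ)⁻¹) η

lemma exists_isMeanTime (hR : R.Irreducible) (W : Set E) (hB : B.Nonempty) :
    ∃ g, IsMeanTime R W B g := by
  classical
  obtain ⟨G, hG⟩ := (isIrredStochastic_prob hR).exists_dirichlet hB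
  refine ⟨G ((W \ B).indicator fun η => (R.holdingRate η : ℝ)⁻¹), fun η hη => ?_, fun η hη => ?_⟩
  · rw [(hG _).1 η hη]
    simp [hη]
  · rw [(hG _).2 η hη]
    by_cases hW : η ∈ W <;> simp [hη, hW]

lemma IsMeanTime.nonneg (hR : R.Irreducible) (hB : B.Nonempty) {g : E → ℝ}
    (hg : IsMeanTime R W B g) (η : E) : 0 ≤ g η := by
  refine (isIrredStochastic_prob hR).nonneg_of_superharmonic hB
    (fun η hη => (hg.eq_zero η hη).ge) (fun η hη => ?_) η
  rw [← sub_nonneg, hg.sub_avg η hη]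
  exact Set.indicator_nonneg (fun η _ => inv_nonneg.2 (holdingRate_pos hR η).le) η

/-- As g vanishes on B and is harmonic off W, it is the harmonic extension of its own restriction to
W ∖ B. The holding rate in the generator then cancels the 1 / λ of the Dirichlet problem. -/
lemma IsMeanTime.traceGen_eq (hR : R.Irreducible) (hW : W.Nonempty) (hBW : B ⊆ W)
    (hH : IsHarmonicExt R.prob W H) {g : E → ℝ} (hg : IsMeanTime R W B g) :
    R.traceGen H (W \ B) ((W \ B).indicator g) = -(W \ B).indicator 1 := by
  have h1 : H ((W \ B).indicator g) = g := by
    refine hH.eq_of_harmonic (isIrredStochastic_prob hR) hW (fun η hη => ?_) fun η hη => ?_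
    · by_cases hηB : η ∈ B
      · simp [hηB, hg.eq_zero η hηB]
      · simp [hηB, hη]
    · have := hg.sub_avg η (fun h => hη (hBW h))
      rw [Set.indicator_of_notMem hη] at this
      linarith
  ext η
  by_cases hη : η ∈ W \ B
  · rw [killedGen_apply_mem hη, Set.indicator_indicator, Set.inter_self, h1,
      Set.indicator_of_mem hη, Pi.neg_apply, Set.indicator_of_mem hη]
    have h2 := hg.sub_avg η hη.2
    rw [Set.indicator_of_mem hη.1] at h2
    have h3 := holdingRate_pos hR η
    have h4 : avg R.prob g η - g η = -(R.holdingRate η : ℝ)⁻¹ := by linarith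
    rw [h4]
    simp [h3.ne']
  · rw [killedGen_apply_notMem hη]
    simp [hη]

end MeanTime

section StayProb

variable {E : Type*} [Fintype E] [MeasurableSpace E] [MeasurableSingletonClass E]

/-- With Z = S the final position gives no further constraint: not having left S by time t implies
being in S at the earlier time s. -/
lemma stayProb_antitone (R : JumpRates E) (W S : Set E) (η : E) {s t : ℝ} (hst : s ≤ t) :
    R.stayProb W S S t η ≤ R.stayProb W S S s η := by
  refine measureReal_mono ?_
  rintro ω ⟨n, -, h2, -, h4⟩
  obtain ⟨m, hm1, hm2⟩ := exists_le_lt_of_exists_lt (R.clock_zero W ω)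
    (t := ENNReal.ofReal s) ⟨n + 1, (ENNReal.ofReal_le_ofReal hst).trans_lt h2⟩
  have hmn : m ≤ n := by
    by_contra! hlt
    have h5 := (R.clock_mono W ω hlt).trans (hm1.trans (ENNReal.ofReal_le_ofReal hst))
    exact not_lt.2 h5 h2
  exact ⟨m, hm1, hm2, h4 m hmn (mem_of_clock_lt (hm1.trans_lt hm2)),
    fun k hk => h4 k (hk.trans hmn)⟩

/-- The trace occupies only one sojourn at time t, so it cannot be both in B and outside it. -/
lemma stayProb_add_stayProb_le_one (R : JumpRates E) (W B : Set E) (t : ℝ) (η : E) :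
    R.stayProb W (W \ B) (W \ B) t η + R.stayProb W W B t η ≤ 1 := by
  unfold stayProb
  rw [← measureReal_union _ (R.measurableSet_stayEvent _ _ _ _)]
  · exact measureReal_le_one
  · refine Set.disjoint_left.2 ?_
    rintro ω ⟨n, h1, h2, h3, -⟩ ⟨m, h4, h5, h6, -⟩
    have hnm : n = m := by
      refine le_antisymm ?_ ?_ <;> by_contra! hlt
      · exact not_lt.2 ((R.clock_mono W ω hlt).trans h1) h5
      · exact not_lt.2 ((R.clock_mono W ω hlt).trans h4) h2
    subst hnm
    exact h3.2 h6

end StayProb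

section Hitting

variable {E : Type*} [Fintype E] [MeasurableSpace E] [MeasurableSingletonClass E] [Nontrivial E]
  {R : JumpRates E} {W S B : Set E} {H : (E → ℝ) →ₗ[ℝ] (E → ℝ)}

/-- The semigroup acts through a nonnegative kernel, which is how positivity and comparison reach
the exponential of A. -/
lemma semigroup_traceGen_apply (hR : R.Irreducible) (hW : W.Nonempty) (hSW : S ⊆ W)
    (hH : IsHarmonicExt R.prob W H) {t : ℝ} (ht : 0 ≤ t) {η : E} (hη : η ∈ S) {f : E → ℝ}
    (hf : ∀ ζ ∉ S, f ζ = 0) :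
    semigroup (R.traceGen H S) t f η = ∑ ζ, f ζ * R.stayProb W S {ζ} t η := by
  classical
  have hdec : f = ∑ ζ, f ζ • ({ζ} : Set E).indicator (1 : E → ℝ) := by
    ext ξ
    simp [Finset.sum_apply, Pi.single_apply]
  conv_lhs => rw [hdec]
  rw [map_sum, Finset.sum_apply]
  refine Finset.sum_congr rfl fun ζ _ => ?_
  rw [map_smul, Pi.smul_apply, smul_eq_mul]
  by_cases hζ : ζ ∈ S
  · rw [stayProb_eq_semigroup hR hW hSW (Set.singleton_subset_iff.2 hζ) hH ht hη]
  · rw [hf ζ hζ, zero_mul, zero_mul]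

variable {g : E → ℝ}

/-- Dynkin's formula, in differential form, for the mean time spent in `W` before hitting `B`. -/
lemma IsMeanTime.hasDerivAt (hR : R.Irreducible) (hW : W.Nonempty) (hBW : B ⊆ W)
    (hH : IsHarmonicExt R.prob W H) (hg : IsMeanTime R W B g) {η : E} (hη : η ∈ W \ B)
    {s : ℝ} (hs : 0 ≤ s) :
    HasDerivAt (fun s => semigroup (R.traceGen H (W \ B)) s ((W \ B).indicator g) η)
      (-R.stayProb W (W \ B) (W \ B) s η) s := by
  have h := hasDerivAt_pi.1 (hasDerivAt_semigroup (R.traceGen H (W \ B)) s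
    ((W \ B).indicator g)) η
  rw [hg.traceGen_eq hR hW hBW hH, map_neg, Pi.neg_apply,
    ← stayProb_eq_semigroup hR hW Set.sdiff_subset subset_rfl hH hs hη] at h
  exact h

/-- Markov's inequality for the time spent in `W` before hitting `B`. -/
lemma IsMeanTime.mul_stayProb_le (hR : R.Irreducible) (hB : B.Nonempty) (hBW : B ⊆ W)
    (hg : IsMeanTime R W B g) {η : E} (hη : η ∈ W \ B) {δ : ℝ} (hδ : 0 ≤ δ) :
    δ * R.stayProb W (W \ B) (W \ B) δ η ≤ g η := by
  have hW := hB.mono hBW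
  obtain ⟨H, hH⟩ := (isIrredStochastic_prob hR).exists_isHarmonicExt hW
  set φ : ℝ → ℝ := fun s => semigroup (R.traceGen H (W \ B)) s ((W \ B).indicator g) η
  have hd : ∀ s, 0 ≤ s → HasDerivAt φ (-R.stayProb W (W \ B) (W \ B) s η) s :=
    fun s hs => hg.hasDerivAt hR hW hBW hH hη hs
  -- On [0, δ] the survival probability is at least its value at δ, so φ falls at least at that
  -- rate.
  have h1 : φ δ - φ 0 ≤ -R.stayProb W (W \ B) (W \ B) δ η * (δ - 0) := by
    refine Convex.image_sub_le_mul_sub_of_deriv_le (convex_Icc 0 δ)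
      (fun s hs => (hd s hs.1).continuousAt.continuousWithinAt)
      (fun s hs => ?_) (fun s hs => ?_) 0 (Set.left_mem_Icc.2 hδ) δ (Set.right_mem_Icc.2 hδ) hδ
    · rw [interior_Icc] at hs
      exact (hd s hs.1.le).differentiableAt.differentiableWithinAt
    · rw [interior_Icc] at hs
      rw [(hd s hs.1.le).deriv, neg_le_neg_iff]
      exact R.stayProb_antitone _ _ η hs.2.le
  have h2 : φ 0 = g η := by simp [φ, semigroup_zero, hη.1, hη.2]
  have h3 : 0 ≤ φ δ := by
    simp only [φ]
    rw [semigroup_traceGen_apply hR hW Set.sdiff_subset hH hδ hη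
      (fun ζ hζ => Set.indicator_of_notMem hζ _)]
    exact Finset.sum_nonneg fun ζ _ => mul_nonneg
      (Set.indicator_nonneg (fun η _ => hg.nonneg hR hB η) ζ) (R.stayProb_nonneg _ _ _ _ _)
  linarith

/-- If the trace on `W` is in `B` at time `t` with a probability at least `c`, then the hitting time
of `B` by the trace has a mean of at most `t / c`. -/
lemma mul_stayProb_le_div (hR : R.Irreducible) (hB : B.Nonempty) (hBW : B ⊆ W) {t c : ℝ}
    (ht : 0 ≤ t) (hc : 0 < c) (hc' : ∀ η ∈ W, c ≤ R.stayProb W W B t η) {η : E} (hη : η ∈ W)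
    {δ : ℝ} (hδ : 0 ≤ δ) : δ * R.stayProb W (W \ B) (W \ B) δ η ≤ t / c := by
  classical
  by_cases hηB : η ∈ B
  · rw [R.stayProb_of_mem_of_notMem hη (fun h => h.2 hηB), mul_zero]
    positivity
  have hηS : η ∈ W \ B := ⟨hη, hηB⟩
  have hW := hB.mono hBW
  obtain ⟨g, hg⟩ := exists_isMeanTime hR W hB
  obtain ⟨H, hH⟩ := (isIrredStochastic_prob hR).exists_isHarmonicExt hW
  refine (hg.mul_stayProb_le hR hB hBW hηS hδ).trans ?_
  -- At the maximum of g, the mean time still to run at time t is at most g(m) times the survival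
  -- probability, hence at most (1 - c) g(m). Dynkin's formula bounds the decrease by t, so c g(m) ≤
  -- t.
  obtain ⟨m, hm, hmax⟩ := Set.exists_max_image (W \ B) g (Set.toFinite _) ⟨η, hηS⟩
  refine (hmax η hηS).trans ?_
  set φ : ℝ → ℝ := fun s => semigroup (R.traceGen H (W \ B)) s ((W \ B).indicator g) m
  have hd : ∀ s, 0 ≤ s → HasDerivAt φ (-R.stayProb W (W \ B) (W \ B) s m) s :=
    fun s hs => hg.hasDerivAt hR hW hBW hH hm hs
  have h1 : -1 * (t - 0) ≤ φ t - φ 0 := by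
    refine Convex.mul_sub_le_image_sub_of_le_deriv (convex_Icc 0 t)
      (fun s hs => (hd s hs.1).continuousAt.continuousWithinAt)
      (fun s hs => ?_) (fun s hs => ?_) 0 (Set.left_mem_Icc.2 ht) t (Set.right_mem_Icc.2 ht) ht
    · rw [interior_Icc] at hs
      exact (hd s hs.1.le).differentiableAt.differentiableWithinAt
    · rw [interior_Icc] at hs
      rw [(hd s hs.1.le).deriv, neg_le_neg_iff]
      exact R.stayProb_le_one _ _ _ _ _
  have h2 : φ 0 = g m := by simp [φ, semigroup_zero, hm.1, hm.2]
  have h3 : φ t ≤ g m * R.stayProb W (W \ B) (W \ B) t m := by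
    simp only [φ]
    rw [stayProb_eq_semigroup hR hW Set.sdiff_subset subset_rfl hH ht hm,
      semigroup_traceGen_apply hR hW Set.sdiff_subset hH ht hm
        (fun ζ hζ => Set.indicator_of_notMem hζ _),
      semigroup_traceGen_apply hR hW Set.sdiff_subset hH ht hm
        (fun ζ hζ => Set.indicator_of_notMem hζ _), Finset.mul_sum]
    refine Finset.sum_le_sum fun ζ _ => ?_
    rw [← mul_assoc]
    refine mul_le_mul_of_nonneg_right ?_ (R.stayProb_nonneg _ _ _ _ _)
    by_cases hζ : ζ ∈ W \ B
    · rw [Set.indicator_of_mem hζ, Set.indicator_of_mem hζ, Pi.one_apply, mul_one]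
      exact hmax ζ hζ
    · rw [Set.indicator_of_notMem hζ, Set.indicator_of_notMem hζ, mul_zero]
  have h4 := R.stayProb_add_stayProb_le_one W B t m
  have h5 := hc' m hm.1
  have h6 : g m * R.stayProb W (W \ B) (W \ B) t m ≤ g m * (1 - c) :=
    mul_le_mul_of_nonneg_left (by linarith) (hg.nonneg hR hB m)
  rw [le_div_iff₀ hc]
  linarith

end Hitting

/-! ## The stationary state -/

section Stationary

variable {E : Type*} [Fintype E] [Nontrivial E] {R : JumpRates E} {μ : E → ℝ≥0}

lemma rate_eq (hR : R.Irreducible) (η ζ : E) :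
    (R.rate η ζ : ℝ) = R.holdingRate η * R.prob η ζ := by
  unfold prob
  rw [mul_div_cancel₀ _ (holdingRate_pos hR η).ne']

lemma IsStationary.sum_mul_prob (hR : R.Irreducible) (hμ : R.IsStationary μ) (ζ : E) :
    ∑ η, (μ η * R.holdingRate η : ℝ) * R.prob η ζ = μ ζ * R.holdingRate ζ := by
  have h := congrArg (fun x : ℝ≥0 => (x : ℝ)) (hμ.balance ζ)
  simp only [NNReal.coe_sum, NNReal.coe_mul, rate_eq hR] at h
  simpa only [mul_assoc] using h

lemma IsStationary.sum_mul_avg (hR : R.Irreducible) (hμ : R.IsStationary μ) (f : E → ℝ) :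
    ∑ η, (μ η * R.holdingRate η : ℝ) * avg R.prob f η =
      ∑ η, (μ η * R.holdingRate η : ℝ) * f η := by
  simp only [avg_apply, Finset.mul_sum]
  rw [Finset.sum_comm]
  simp only [← mul_assoc, ← Finset.sum_mul, hμ.sum_mul_prob hR]

/-- The jump matrix of the adjoint chain. -/
def adjProb (R : JumpRates E) (μ : E → ℝ≥0) (η ζ : E) : ℝ :=
  (μ ζ * R.holdingRate ζ) * R.prob ζ η / (μ η * R.holdingRate η)

lemma IsStationary.mul_holdingRate_pos (hR : R.Irreducible) (hμ : R.IsStationary μ) (η : E) :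
    0 < (μ η * R.holdingRate η : ℝ) :=
  mul_pos (by exact_mod_cast hμ.pos hR η) (holdingRate_pos hR η)

lemma isIrredStochastic_adjProb (hR : R.Irreducible) (hμ : R.IsStationary μ) :
    IsIrredStochastic (R.adjProb μ) where
  nonneg η ζ := div_nonneg (mul_nonneg (hμ.mul_holdingRate_pos hR ζ).le (R.prob_nonneg _ _))
    (hμ.mul_holdingRate_pos hR η).le
  sum_eq_one η := by
    unfold adjProb
    rw [← Finset.sum_div, hμ.sum_mul_prob hR, div_self (hμ.mul_holdingRate_pos hR η).ne']
  irred η ζ := by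
    have h : (Function.swap fun a b => 0 < R.prob a b) ≤ fun a b => 0 < R.adjProb μ a b :=
      fun a b hab => div_pos (mul_pos (hμ.mul_holdingRate_pos hR b) hab)
        (hμ.mul_holdingRate_pos hR a)
    refine Relation.ReflTransGen.mono h _ _ ?_
    rw [Relation.reflTransGen_swap]
    exact (isIrredStochastic_prob hR).irred ζ η

/-- Summation by parts: `adjProb` is the transpose of p in the measure μλ, which is invariant for
the jump chain. -/
lemma IsStationary.sum_mul_avg_adjoint (hR : R.Irreducible) (hμ : R.IsStationary μ)
    (f g : E → ℝ) :
    ∑ η, (μ η * R.holdingRate η : ℝ) * (f η * (g η - avg R.prob g η)) =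
      ∑ η, (μ η * R.holdingRate η : ℝ) * ((f η - avg (R.adjProb μ) f η) * g η) := by
  have key : ∑ η, (μ η * R.holdingRate η : ℝ) * (f η * avg R.prob g η) =
      ∑ η, (μ η * R.holdingRate η : ℝ) * (avg (R.adjProb μ) f η * g η) := by
    simp only [avg_apply, Finset.mul_sum, Finset.sum_mul]
    rw [Finset.sum_comm]
    refine Finset.sum_congr rfl fun η _ => Finset.sum_congr rfl fun ζ _ => ?_
    unfold adjProb
    have h1 := (hμ.mul_holdingRate_pos hR η).ne'
    generalize (μ η * R.holdingRate η : ℝ) = x at h1 ⊢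
    field_simp
  simp only [mul_sub, sub_mul, Finset.sum_sub_distrib, key]

variable [MeasurableSpace E] [MeasurableSingletonClass E]

/-- The mean time spent in `W` before hitting `B` is at most `μ(W ∖ B) / Cap(η, B)`. -/
lemma IsMeanTime.mul_le (hR : R.Irreducible) (hμ : R.IsStationary μ) {W B : Set E}
    {g : E → ℝ} (hg : IsMeanTime R W B g) {η : E} (hη : η ∉ B) :
    g η * (μ η * R.holdingRate η * avg R.prob (R.hitProb B η) η) ≤
      ∑ ζ, (W \ B).indicator (fun ζ => (μ ζ : ℝ)) ζ := by
  classical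
  have hp := isIrredStochastic_adjProb hR hμ
  set V : Set E := insert η B with hV
  have hVne : V.Nonempty := ⟨η, Set.mem_insert _ _⟩
  obtain ⟨G, hG⟩ := hp.exists_dirichlet hVne
  -- The equilibrium potential of the adjoint chain between η and B: 1 at η, 0 on B, harmonic
  -- elsewhere, and at most 1 by the maximum principle.
  set k := G (({η} : Set E).indicator 1) with hk
  have kη : k η = 1 := by rw [hk, (hG _).1 η (Set.mem_insert _ _)]; simp
  have kB : ∀ ζ ∈ B, k ζ = 0 := fun ζ hζ => by
    have : ζ ≠ η := fun h => hη (h ▸ hζ)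
    rw [hk, (hG _).1 ζ (Set.mem_insert_of_mem _ hζ)]
    simp [this]
  have kV : ∀ ζ ∉ V, k ζ - avg (R.adjProb μ) k ζ = 0 := fun ζ hζ => by
    have : ζ ≠ η := fun h => hζ (h ▸ Set.mem_insert _ _)
    rw [hk, (hG _).2 ζ hζ]
    simp [this]
  have kVb : ∀ ζ ∈ V, k ζ ≤ 1 := by
    rintro ζ (rfl | hζ)
    · exact kη.le
    · rw [kB ζ hζ]; exact zero_le_one
  have k1 : ∀ ζ, k ζ ≤ 1 := by
    intro ζ
    have := hp.nonpos_of_subharmonic hVne (g := k - fun _ => 1)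
      (fun ζ hζ => by simpa using kVb ζ hζ)
      (fun ζ hζ => by
        rw [map_sub, Pi.sub_apply, Pi.sub_apply, hp.avg_const]
        linarith [kV ζ hζ]) ζ
    simpa using this
  set q := R.hitProb B η with hq
  -- After the summation by parts only η remains: g vanishes on B, and k is harmonic off B ∪ {η}.
  have e1 : ∑ ζ, (μ ζ * R.holdingRate ζ : ℝ) * (k ζ * (g ζ - avg R.prob g ζ)) =
      (μ η * R.holdingRate η : ℝ) * ((1 - avg (R.adjProb μ) k η) * g η) := by
    rw [hμ.sum_mul_avg_adjoint hR, Finset.sum_eq_single η]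
    · rw [kη]
    · intro ζ _ hζ
      by_cases hζB : ζ ∈ B
      · rw [hg.eq_zero ζ hζB]; ring
      · rw [kV ζ (fun h => h.elim hζ hζB)]; ring
    · simp
  -- The chain and its adjoint have the same capacity: k is paired with 1 - q, the probability of
  -- not hitting B before η, and both sums reduce to their term at η.
  have e2 : (μ η * R.holdingRate η : ℝ) * avg R.prob q η =
      (μ η * R.holdingRate η : ℝ) * (1 - avg (R.adjProb μ) k η) := by
    have h := hμ.sum_mul_avg_adjoint hR k ((fun _ => (1 : ℝ)) - q : E → ℝ)
    have hav : ∀ ζ, ((fun _ => (1 : ℝ)) - q : E → ℝ) ζ - avg R.prob ((fun _ => 1) - q) ζ =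
        avg R.prob q ζ - q ζ := fun ζ => by
      rw [map_sub, Pi.sub_apply, Pi.sub_apply, (isIrredStochastic_prob hR).avg_const]
      ring
    rw [Finset.sum_eq_single η, Finset.sum_eq_single η] at h
    · rw [hav, kη, hq, R.hitProb_self, Pi.sub_apply, R.hitProb_self] at h
      simpa using h
    · intro ζ _ hζ
      by_cases hζB : ζ ∈ B
      · rw [Pi.sub_apply, hq, R.hitProb_of_mem hη hζB]; ring
      · rw [kV ζ (fun h => h.elim hζ hζB)]; ring
    · simp
    · intro ζ _ hζ
      by_cases hζB : ζ ∈ B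
      · rw [kB ζ hζB]; ring
      · rw [hav, hq, ← hitProb_of_notMem hR hζB hζ]; ring
    · simp
  calc g η * (μ η * R.holdingRate η * avg R.prob q η)
      = ∑ ζ, (μ ζ * R.holdingRate ζ : ℝ) * (k ζ * (g ζ - avg R.prob g ζ)) := by
        rw [e1, e2]; ring
    _ ≤ _ := by
        refine Finset.sum_le_sum fun ζ _ => ?_
        by_cases hζB : ζ ∈ B
        · rw [kB ζ hζB, zero_mul, mul_zero]
          exact Set.indicator_nonneg (fun _ _ => NNReal.coe_nonneg _) ζ
        · rw [hg.sub_avg ζ hζB]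
          by_cases hζW : ζ ∈ W
          · rw [Set.indicator_of_mem hζW, Set.indicator_of_mem (show ζ ∈ W \ B from ⟨hζW, hζB⟩)]
            have h1 := (holdingRate_pos hR ζ).ne'
            have h2 : (μ ζ * R.holdingRate ζ : ℝ) * (k ζ * (R.holdingRate ζ : ℝ)⁻¹) =
                μ ζ * k ζ := by field_simp
            rw [h2]
            exact mul_le_of_le_one_right (NNReal.coe_nonneg _) (k1 ζ)
          · rw [Set.indicator_of_notMem hζW, mul_zero, mul_zero]
            exact Set.indicator_nonneg (fun _ _ => NNReal.coe_nonneg _) ζ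

/-- The bound on the hitting time in terms of the capacity. -/
lemma law_lt_traceHittingTime_le_capacity (hR : R.Irreducible)
    (hμ : R.IsStationary μ) {W B : Finset E} [DecidableEq E] (hB : B.Nonempty) (hBW : B ⊆ W) {η : E}
    (hη : η ∈ W \ B) {δ : ℝ} (hδ : 0 < δ) :
    R.law η {ω | ENNReal.ofReal δ <
        traceHittingTime (R.chain ω) (W : Set E) (B : Set E)} ≤
      ENNReal.ofReal δ⁻¹ * ((mass μ (W \ B) : ℝ≥0∞) / R.capacity μ {η} B) := by
  have hη' : η ∈ (W : Set E) \ B := by simpa using hη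
  have hBs : (B : Set E).Nonempty := by simpa using hB
  have hBWs : (B : Set E) ⊆ W := by simpa using hBW
  obtain ⟨g, hg⟩ := exists_isMeanTime hR (W : Set E) hBs
  have h1 := hg.mul_stayProb_le hR hBs hBWs hη' hδ.le
  have h2 := hg.mul_le hR hμ hη'.2
  have hmass : ∑ ζ, ((W : Set E) \ B).indicator (fun ζ => (μ ζ : ℝ)) ζ = mass μ (W \ B) := by
    unfold mass
    rw [NNReal.coe_sum, ← Finset.coe_sdiff,
      Finset.sum_indicator_subset _ (Finset.subset_univ _)]
  rw [hmass] at h2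
  have hg0 := hg.nonneg hR hBs η
  have hcap : R.capacity μ {η} B ≤
      ENNReal.ofReal (μ η * R.holdingRate η * avg R.prob (R.hitProb B η) η) := by
    unfold capacity
    rw [Finset.sum_singleton, ENNReal.ofReal_mul (by positivity),
      ENNReal.ofReal_mul (by positivity), ENNReal.ofReal_coe_nnreal, ENNReal.ofReal_coe_nnreal, Finset.coe_singleton]
    gcongr
    exact law_hittingTime_lt_returnTime_le hR hη'.2
  refine (law_lt_traceHittingTime_le hR (hBs.mono hBWs) _ δ η).trans ?_
  have h3 : R.stayProb W (W \ B) (W \ B) δ η ≤ δ⁻¹ * g η := by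
    rw [inv_mul_eq_div, le_div_iff₀ hδ, mul_comm]; exact h1
  refine (ENNReal.ofReal_le_ofReal h3).trans ?_
  rw [ENNReal.ofReal_mul (by positivity)]
  gcongr
  have hcaptop : R.capacity μ {η} B ≠ ⊤ := ne_top_of_le_ne_top ENNReal.ofReal_ne_top hcap
  -- A positive numerator makes the quotient infinite if the capacity is 0, so that this case needs
  -- no exclusion.
  have hmpos : (mass μ (W \ B) : ℝ≥0∞) ≠ 0 := by
    have : 0 < mass μ (W \ B) := Finset.sum_pos (fun ζ _ => hμ.pos hR ζ) ⟨η, hη⟩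
    exact_mod_cast this.ne'
  rw [ENNReal.le_div_iff_mul_le (Or.inr hmpos) (Or.inl hcaptop)]
  calc ENNReal.ofReal (g η) * R.capacity μ {η} B
      ≤ ENNReal.ofReal (g η) *
        ENNReal.ofReal (μ η * R.holdingRate η * avg R.prob (R.hitProb B η) η) := by gcongr
    _ = ENNReal.ofReal (g η * (μ η * R.holdingRate η * avg R.prob (R.hitProb B η) η)) :=
        (ENNReal.ofReal_mul hg0).symm
    _ ≤ ENNReal.ofReal (mass μ (W \ B)) := ENNReal.ofReal_le_ofReal h2
    _ = mass μ (W \ B) := ENNReal.ofReal_coe_nnreal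

end Stationary

end JumpRates

/-! ## Total variation distance -/

section TotalVariation

variable {E : Type*} [Fintype E]

lemma sum_abs_sub_le {a b p : E → ℝ} {d : ℝ} (ha : tvDist a p ≤ d) (hb : tvDist b p ≤ d) :
    ∑ ζ, |a ζ - b ζ| ≤ 4 * d := by
  unfold tvDist at ha hb
  have : ∑ ζ, |a ζ - b ζ| ≤ ∑ ζ, (|a ζ - p ζ| + |b ζ - p ζ|) :=
    Finset.sum_le_sum fun ζ _ => by
      rw [abs_sub_comm (b ζ)]
      exact abs_sub_le _ _ _
  rw [Finset.sum_add_distrib] at this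
  linarith

/-- The difference of the means of a function of oscillation `D`. -/
lemma sum_mul_sub_sum_mul_le {a b p f : E → ℝ} {d lo D : ℝ} (hab : ∑ ζ, a ζ = ∑ ζ, b ζ)
    (ha : tvDist a p ≤ d) (hb : tvDist b p ≤ d)
    (hf : ∀ ζ, a ζ ≠ b ζ → lo ≤ f ζ ∧ f ζ ≤ lo + D) (hD : 0 ≤ D) :
    ∑ ζ, f ζ * a ζ - ∑ ζ, f ζ * b ζ ≤ 2 * d * D := by
  -- As `a` and `b` have equal mass, f may be centred at the midpoint of its range, which makes it
  -- at most D / 2 in absolute value.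
  have h1 : ∑ ζ, f ζ * a ζ - ∑ ζ, f ζ * b ζ = ∑ ζ, (f ζ - (lo + D / 2)) * (a ζ - b ζ) := by
    simp only [sub_mul, mul_sub, Finset.sum_sub_distrib, ← Finset.mul_sum, hab]
    ring
  rw [h1]
  calc ∑ ζ, (f ζ - (lo + D / 2)) * (a ζ - b ζ) ≤ ∑ ζ, D / 2 * |a ζ - b ζ| := by
        refine Finset.sum_le_sum fun ζ _ => ?_
        by_cases h : a ζ = b ζ
        · simp [h]
        · obtain ⟨h2, h3⟩ := hf ζ h
          refine (le_abs_self _).trans ?_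
          rw [abs_mul]
          refine mul_le_mul_of_nonneg_right (abs_le.2 ⟨by linarith, by linarith⟩) (abs_nonneg _)
    _ = D / 2 * ∑ ζ, |a ζ - b ζ| := by rw [Finset.mul_sum]
    _ ≤ D / 2 * (4 * d) := mul_le_mul_of_nonneg_left (sum_abs_sub_le ha hb) (by positivity)
    _ = 2 * d * D := by ring

/-- Two distributions which are close to `p` overlap with respect to `p`. -/
lemma sq_le_sum_mul_div {W : Finset E} {a b p : E → ℝ} {d : ℝ} (hd : 2 * d ≤ 1)
    (ha0 : ∀ ζ, 0 ≤ a ζ) (hb0 : ∀ ζ, 0 ≤ b ζ) (ha1 : ∑ ζ, a ζ = 1) (hb1 : ∑ ζ, b ζ = 1)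
    (haW : ∀ ζ ∉ W, a ζ = 0) (hp : ∀ ζ ∈ W, 0 < p ζ) (hp1 : ∑ ζ ∈ W, p ζ = 1)
    (ha : tvDist a p ≤ d) (hb : tvDist b p ≤ d) :
    (1 - 2 * d) ^ 2 ≤ ∑ ζ ∈ W, a ζ * b ζ / p ζ := by
  have h1 : 1 - 2 * d ≤ ∑ ζ ∈ W, min (a ζ) (b ζ) := by
    have h2 : ∑ ζ ∈ W, min (a ζ) (b ζ) = ∑ ζ, min (a ζ) (b ζ) :=
      Finset.sum_subset (Finset.subset_univ _) fun ζ _ hζ => by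
        rw [haW ζ hζ]; exact min_eq_left (hb0 ζ)
    have h3 : ∑ ζ, min (a ζ) (b ζ) = 1 - (1 / 2) * ∑ ζ, |a ζ - b ζ| := by
      have : ∀ ζ, min (a ζ) (b ζ) = (1 / 2) * a ζ + (1 / 2) * b ζ - (1 / 2) * |a ζ - b ζ| := by
        intro ζ
        rcases le_total (a ζ) (b ζ) with h | h
        · rw [min_eq_left h, abs_of_nonpos (sub_nonpos.2 h)]; ring
        · rw [min_eq_right h, abs_of_nonneg (sub_nonneg.2 h)]; ring
      simp only [this, Finset.sum_sub_distrib, Finset.sum_add_distrib, ← Finset.mul_sum, ha1, hb1]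
      ring
    rw [h2, h3]
    linarith [sum_abs_sub_le ha hb]
  -- Cauchy–Schwarz with the weights p, of total mass 1, applied to the common part min(a, b), whose
  -- square is at most ab.
  calc (1 - 2 * d) ^ 2 ≤ (∑ ζ ∈ W, min (a ζ) (b ζ)) ^ 2 :=
        pow_le_pow_left₀ (by linarith) h1 2
    _ = (∑ ζ ∈ W, min (a ζ) (b ζ)) ^ 2 / ∑ ζ ∈ W, p ζ := by rw [hp1, div_one]
    _ ≤ ∑ ζ ∈ W, min (a ζ) (b ζ) ^ 2 / p ζ := Finset.sq_sum_div_le_sum_sq_div W _ hp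
    _ ≤ ∑ ζ ∈ W, a ζ * b ζ / p ζ := by
        refine Finset.sum_le_sum fun ζ hζ => ?_
        refine div_le_div_of_nonneg_right ?_ (hp ζ hζ).le
        rw [sq]
        exact mul_le_mul (min_le_left _ _) (min_le_right _ _) (le_min (ha0 ζ) (hb0 ζ)) (ha0 ζ)

end TotalVariation

namespace JumpRates

/-! ## Invariance and reversibility of the trace process -/

section Invariance

variable {E : Type*} [Fintype E] {R : JumpRates E} {μ : E → ℝ≥0} {W : Set E}
  {H : (E → ℝ) →ₗ[ℝ] (E → ℝ)}

/-- Harmonicity makes the right side vanish off W. Sums over W against μ thus become sums over E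
against μλ, where stationarity and reversibility of the jump chain apply directly. -/
lemma indicator_mul_traceGen (μ : E → ℝ≥0) (hH : IsHarmonicExt R.prob W H) (f : E → ℝ) (η : E) :
    W.indicator (fun η => (μ η : ℝ)) η * R.traceGen H W f η =
      (μ η * R.holdingRate η : ℝ) *
        (avg R.prob (H (W.indicator f)) η - H (W.indicator f) η) := by
  by_cases hη : η ∈ W
  · rw [Set.indicator_of_mem hη, killedGen_apply_mem hη, (hH _).1 η hη, Set.indicator_of_mem hη]
    ring
  · rw [Set.indicator_of_notMem hη, ← (hH _).2 η hη]
    ring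

variable [Nontrivial E]

lemma IsStationary.sum_indicator_mul_semigroup (hR : R.Irreducible) (hμ : R.IsStationary μ)
    (hH : IsHarmonicExt R.prob W H) (t : ℝ) (f : E → ℝ) :
    ∑ η, W.indicator (fun η => (μ η : ℝ)) η * semigroup (R.traceGen H W) t f η =
      ∑ η, W.indicator (fun η => (μ η : ℝ)) η * f η := by
  let φ : (E → ℝ) →L[ℝ] ℝ :=
    ∑ η, W.indicator (fun η => (μ η : ℝ)) η • ContinuousLinearMap.proj η
  have hφ : ∀ f, φ f = ∑ η, W.indicator (fun η => (μ η : ℝ)) η * f η := by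
    intro f
    simp [φ]
  have := map_semigroup_of_map_gen_eq_zero (R.traceGen H W) φ (fun f => by
    rw [hφ]
    simp only [indicator_mul_traceGen μ hH, mul_sub, Finset.sum_sub_distrib]
    rw [hμ.sum_mul_avg hR, sub_self]) t f
  simpa only [hφ] using this

/-- The bilinear form of the trace generator is that of p - 1 in μλ evaluated at the harmonic
extensions, and detailed balance makes p symmetric there. -/
lemma Reversible.semigroup_symm (hR : R.Irreducible) (hrev : R.Reversible μ)
    (hH : IsHarmonicExt R.prob W H) (t : ℝ) (f g : E → ℝ) :
    ∑ η, W.indicator (fun η => (μ η : ℝ)) η * (semigroup (R.traceGen H W) t f η * g η) =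
      ∑ η, W.indicator (fun η => (μ η : ℝ)) η * (f η * semigroup (R.traceGen H W) t g η) := by
  refine Metastable.semigroup_symm _ _ (fun f g => ?_) t f g
  have hdir : ∀ f g : E → ℝ, ∑ η, W.indicator (fun η => (μ η : ℝ)) η *
      (R.traceGen H W f η * g η) = ∑ η, (μ η * R.holdingRate η : ℝ) *
        ((avg R.prob (H (W.indicator f)) η - H (W.indicator f) η) * H (W.indicator g) η) := by
    intro f g
    refine Finset.sum_congr rfl fun η _ => ?_
    rw [← mul_assoc, ← mul_assoc, indicator_mul_traceGen μ hH]
    by_cases hη : η ∈ W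
    · rw [(hH (W.indicator g)).1 η hη, Set.indicator_of_mem hη]
    · rw [← (hH (W.indicator f)).2 η hη]
      ring
  have hsymm : ∀ f g : E → ℝ, ∑ η, (μ η * R.holdingRate η : ℝ) * (avg R.prob f η * g η) =
      ∑ η, (μ η * R.holdingRate η : ℝ) * (avg R.prob g η * f η) := by
    intro f g
    simp only [avg_apply, Finset.mul_sum, Finset.sum_mul]
    rw [Finset.sum_comm]
    refine Finset.sum_congr rfl fun η _ => Finset.sum_congr rfl fun ζ _ => ?_
    have h := congrArg (fun x : ℝ≥0 => (x : ℝ)) (hrev η ζ)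
    simp only [NNReal.coe_mul, rate_eq hR] at h
    linear_combination (-(f η * g ζ)) * h
  have hcomm : ∑ η, W.indicator (fun η => (μ η : ℝ)) η * (f η * R.traceGen H W g η) =
      ∑ η, W.indicator (fun η => (μ η : ℝ)) η * (R.traceGen H W g η * f η) := by
    simp only [mul_comm (f _)]
  rw [hcomm, hdir, hdir]
  simp only [sub_mul, mul_sub, Finset.sum_sub_distrib]
  rw [hsymm]
  simp only [mul_comm (H (W.indicator f) _)]

end Invariance

section Conditioned

lemma coe_conditioned {E : Type*} (μ : E → ℝ≥0) (W : Finset E) (ζ : E) :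
    (conditioned μ W ζ : ℝ) = (W : Set E).indicator (fun η => (μ η : ℝ)) ζ / mass μ W := by
  unfold conditioned
  by_cases h : ζ ∈ W <;> simp [h]

variable {E : Type*} [Fintype E] {R : JumpRates E} {μ : E → ℝ≥0} {W B : Finset E}

lemma IsStationary.mass_pos (hR : R.Irreducible) (hμ : R.IsStationary μ) (hW : W.Nonempty) :
    0 < (mass μ W : ℝ) := by
  have : 0 < mass μ W := Finset.sum_pos (fun ζ _ => hμ.pos hR ζ) hW
  exact_mod_cast this

lemma coe_mass_conditioned (μ : E → ℝ≥0) (W B : Finset E) :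
    (mass (conditioned μ W) B : ℝ) =
      ∑ η, (conditioned μ W η : ℝ) * (B : Set E).indicator 1 η := by
  classical
  unfold mass
  rw [NNReal.coe_sum, ← Finset.sum_subset (Finset.subset_univ B)]
  · exact Finset.sum_congr rfl fun η hη => by simp [hη]
  · intro η _ hη
    simp [hη]

lemma IsStationary.sum_conditioned (hR : R.Irreducible) (hμ : R.IsStationary μ)
    (hW : W.Nonempty) : ∑ η ∈ W, (conditioned μ W η : ℝ) = 1 := by
  have h1 : ∑ η ∈ W, (conditioned μ W η : ℝ) = (∑ η ∈ W, (μ η : ℝ)) / mass μ W := by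
    rw [Finset.sum_div]
    exact Finset.sum_congr rfl fun η hη => by rw [coe_conditioned]; simp [hη]
  have h2 : (mass μ W : ℝ) = ∑ η ∈ W, (μ η : ℝ) := by simp [mass]
  rw [h1, ← h2, div_self (hμ.mass_pos hR hW).ne']

lemma IsStationary.conditioned_pos (hR : R.Irreducible) (hμ : R.IsStationary μ) {η : E}
    (hη : η ∈ W) : 0 < (conditioned μ W η : ℝ) := by
  rw [coe_conditioned, Set.indicator_of_mem (by simpa using hη)]
  exact div_pos (by exact_mod_cast hμ.pos hR η) (hμ.mass_pos hR ⟨η, hη⟩)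

lemma IsStationary.mass_conditioned_pos (hR : R.Irreducible) (hμ : R.IsStationary μ)
    (hB : B.Nonempty) (hBW : B ⊆ W) : 0 < (mass (conditioned μ W) B : ℝ) := by
  unfold mass
  rw [NNReal.coe_sum]
  exact Finset.sum_pos (fun η hη => hμ.conditioned_pos hR (hBW hη)) hB

lemma IsStationary.mass_conditioned_le_one (hR : R.Irreducible) (hμ : R.IsStationary μ)
    (hB : B.Nonempty) (hBW : B ⊆ W) : (mass (conditioned μ W) B : ℝ) ≤ 1 := by
  rw [← hμ.sum_conditioned hR (hB.mono hBW)]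
  unfold mass
  rw [NNReal.coe_sum]
  exact Finset.sum_le_sum_of_subset_of_nonneg hBW fun _ _ _ => NNReal.coe_nonneg _

end Conditioned

/-! ## Hitting times and mixing times -/

section MixingTime

variable {E : Type*} [Fintype E] [MeasurableSpace E] [MeasurableSingletonClass E]

lemma stayProb_singleton_of_notMem (R : JumpRates E) {W : Set E} {ζ : E} (hζ : ζ ∉ W) (t : ℝ)
    (η : E) : R.stayProb W W {ζ} t η = 0 := by
  unfold stayProb
  have : R.stayEvent W W {ζ} t = ∅ := by
    refine Set.eq_empty_of_forall_notMem ?_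
    rintro ω ⟨n, h1, h2, h3, -⟩
    have h4 := mem_of_clock_lt (h1.trans_lt h2)
    rw [Set.mem_singleton_iff.1 h3] at h4
    exact hζ h4
  rw [this, measureReal_empty]

variable [Nontrivial E] {R : JumpRates E} {μ : E → ℝ≥0} {W B : Finset E}

/-- The trace process on `W` is close to the conditioned stationary state at time `t`. -/
def IsMixedAt (R : JumpRates E) (μ : E → ℝ≥0) (W : Finset E) (t : ℝ) : Prop :=
  ∀ η ∈ W, tvDist (R.traceSemigroup W t η) (fun ζ => (conditioned μ W ζ : ℝ)) ≤
    1 / (2 * Real.exp 1)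

lemma sum_stayProb_singleton (hR : R.Irreducible) {W : Set E} {t : ℝ} (ht : 0 ≤ t) {η : E}
    (hη : η ∈ W) : ∑ ζ, R.stayProb W W {ζ} t η = 1 := by
  have hW : W.Nonempty := ⟨η, hη⟩
  obtain ⟨H, hH⟩ := (isIrredStochastic_prob hR).exists_isHarmonicExt hW
  have h1 := semigroup_traceGen_apply hR hW subset_rfl hH ht hη
    (f := W.indicator 1) (fun ζ hζ => Set.indicator_of_notMem hζ _)
  rw [semigroup_apply_of_gen_eq_zero _ (traceGen_indicator_self hR hW hH),
    Set.indicator_of_mem hη, Pi.one_apply] at h1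
  rw [h1]
  refine Finset.sum_congr rfl fun ζ _ => ?_
  by_cases hζ : ζ ∈ W
  · simp [hζ]
  · rw [R.stayProb_singleton_of_notMem hζ, mul_zero]

lemma IsMixedAt.tvDist_le (hR : R.Irreducible) {t : ℝ} (h : R.IsMixedAt μ W t) {η : E}
    (hη : η ∈ W) : tvDist (fun ζ => R.stayProb W W {ζ} t η)
      (fun ζ => (conditioned μ W ζ : ℝ)) ≤ 1 / (2 * Real.exp 1) := by
  have h1 := h η hη
  have h2 : R.traceSemigroup W t η = fun ζ => R.stayProb W W {ζ} t η :=
    funext fun ζ => traceSemigroup_eq_stayProb hR ⟨η, by simpa using hη⟩ t η ζ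
  rwa [h2] at h1

/-- The semigroup of the trace process contracts the oscillations. -/
lemma IsMixedAt.exists_oscillation_le (hR : R.Irreducible) {t : ℝ} (ht : 0 ≤ t)
    (h : R.IsMixedAt μ W t) (hW : W.Nonempty) {H : (E → ℝ) →ₗ[ℝ] (E → ℝ)}
    (hH : IsHarmonicExt R.prob W H) {f : E → ℝ} (hfW : ∀ ζ ∉ W, f ζ = 0) {lo D : ℝ}
    (hD : 0 ≤ D) (hf : ∀ ζ ∈ W, lo ≤ f ζ ∧ f ζ ≤ lo + D) :
    ∃ lo', ∀ η ∈ W, lo' ≤ semigroup (R.traceGen H W) t f η ∧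
      semigroup (R.traceGen H W) t f η ≤ lo' + Real.exp (-1) * D := by
  obtain ⟨m, hm, hmin⟩ := Finset.exists_min_image W (semigroup (R.traceGen H W) t f) hW
  refine ⟨semigroup (R.traceGen H W) t f m, fun η hη => ⟨hmin η hη, ?_⟩⟩
  have happ : ∀ η ∈ W, semigroup (R.traceGen H W) t f η =
      ∑ ζ, f ζ * R.stayProb W W {ζ} t η := fun η hη =>
    semigroup_traceGen_apply hR (by simpa using hW) subset_rfl hH ht (by simpa using hη)
      (by simpa using hfW)
  have h1 := sum_mul_sub_sum_mul_le (f := f) (lo := lo) (D := D)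
    ((sum_stayProb_singleton hR ht (by simpa using hη)).trans
      (sum_stayProb_singleton hR ht (by simpa using hm)).symm)
    (h.tvDist_le hR hη) (h.tvDist_le hR hm)
    (fun ζ hne => hf ζ (by
      by_contra hζ
      refine hne ?_
      rw [R.stayProb_singleton_of_notMem (by simpa using hζ),
        R.stayProb_singleton_of_notMem (by simpa using hζ)])) hD
  rw [happ η hη, happ m hm]
  -- The threshold 1/(2e) is chosen for this: two starting points are each within 1/(2e) of the
  -- conditioned state, so one mixing time divides the oscillation by e.
  have h2 : 2 * (1 / (2 * Real.exp 1)) * D = Real.exp (-1) * D := by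
    rw [Real.exp_neg]
    have := Real.exp_pos 1
    field_simp
  linarith

/-- After `k` times the time `t`, the probability that the trace process is in `B` differs from its
stationary value by at most `exp (-k)`. -/
lemma IsMixedAt.le_stayProb (hR : R.Irreducible) (hμ : R.IsStationary μ) {t : ℝ}
    (ht : 0 ≤ t) (h : R.IsMixedAt μ W t) (hB : B.Nonempty) (hBW : B ⊆ W) (k : ℕ) {η : E}
    (hη : η ∈ W) :
    (mass (conditioned μ W) B : ℝ) - Real.exp (-k) ≤ R.stayProb W W B (k * t) η := by
  classical
  have hW := hB.mono hBW
  have hWs : (W : Set E).Nonempty := by simpa using hW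
  obtain ⟨H, hH⟩ := (isIrredStochastic_prob hR).exists_isHarmonicExt hWs
  set f : ℕ → E → ℝ := fun k =>
    semigroup (R.traceGen H W) (k * t) ((B : Set E).indicator 1) with hf
  have hfW : ∀ k, ∀ ζ ∉ W, f k ζ = 0 := by
    intro k ζ hζ
    simp only [f]
    rw [semigroup_killedGen_apply_notMem (by simpa using hζ)]
    exact Set.indicator_of_notMem (by simpa using fun h => hζ (hBW h)) _
  have hosc : ∀ k : ℕ, ∃ lo, ∀ ζ ∈ W, lo ≤ f k ζ ∧ f k ζ ≤ lo + Real.exp (-k) := by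
    intro k
    induction k with
    | zero =>
      refine ⟨0, fun ζ _ => ?_⟩
      by_cases hζ : ζ ∈ B <;> simp [f, semigroup_zero, hζ]
    | succ k ih =>
      obtain ⟨lo, hlo⟩ := ih
      obtain ⟨lo', hlo'⟩ := h.exists_oscillation_le hR ht hW hH (hfW k) (Real.exp_pos _).le hlo
      refine ⟨lo', fun ζ hζ => ?_⟩
      have h1 : f (k + 1) = semigroup (R.traceGen H W) t (f k) := by
        simp only [f]
        rw [← semigroup_add]
        congr 1
        push_cast
        ring_nf
      have h2 : Real.exp (-((k + 1 : ℕ) : ℝ)) = Real.exp (-1) * Real.exp (-k) := by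
        rw [← Real.exp_add]
        push_cast
        ring_nf
      rw [h1, h2]
      exact hlo' ζ hζ
  obtain ⟨lo, hlo⟩ := hosc k
  -- By invariance, the conditioned mass of B is the mean of `f k`, which lies within the
  -- oscillation of each of its values.
  have hmass : (mass (conditioned μ W) B : ℝ) = ∑ ζ ∈ W, (conditioned μ W ζ : ℝ) * f k ζ := by
    rw [coe_mass_conditioned μ W B]
    have h1 : ∑ ζ ∈ W, (conditioned μ W ζ : ℝ) * f k ζ =
        ∑ ζ, (conditioned μ W ζ : ℝ) * f k ζ :=
      Finset.sum_subset (Finset.subset_univ _) fun ζ _ hζ => by rw [hfW k ζ hζ, mul_zero]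
    rw [h1]
    simp only [coe_conditioned, div_mul_eq_mul_div, ← Finset.sum_div, f]
    rw [hμ.sum_indicator_mul_semigroup hR hH]
  have hle : (mass (conditioned μ W) B : ℝ) ≤ lo + Real.exp (-k) := by
    rw [hmass]
    calc ∑ ζ ∈ W, (conditioned μ W ζ : ℝ) * f k ζ
        ≤ ∑ ζ ∈ W, (conditioned μ W ζ : ℝ) * (lo + Real.exp (-k)) :=
          Finset.sum_le_sum fun ζ hζ =>
            mul_le_mul_of_nonneg_left (hlo ζ hζ).2 (NNReal.coe_nonneg _)
      _ = lo + Real.exp (-k) := by rw [← Finset.sum_mul, hμ.sum_conditioned hR hW, one_mul]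
  have hstay : R.stayProb W W B (k * t) η = f k η :=
    stayProb_eq_semigroup hR hWs subset_rfl (by simpa using hBW) hH (by positivity)
      (by simpa using hη)
  rw [hstay]
  linarith [(hlo η hη).1]

/-- For reversible chains, the trace process is in `B` at time `2 t` with a probability of the order
of its stationary value. -/
lemma IsMixedAt.le_stayProb_of_reversible (hR : R.Irreducible) (hμ : R.IsStationary μ)
    (hrev : R.Reversible μ) {t : ℝ} (ht : 0 ≤ t) (h : R.IsMixedAt μ W t) (hBW : B ⊆ W) {η : E}
    (hη : η ∈ W) :
    (mass (conditioned μ W) B : ℝ) / 4 ≤ R.stayProb W W B (2 * t) η := by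
  classical
  have hW : W.Nonempty := ⟨η, hη⟩
  have hWs : (W : Set E).Nonempty := by simpa using hW
  obtain ⟨H, hH⟩ := (isIrredStochastic_prob hR).exists_isHarmonicExt hWs
  set A := R.traceGen H (W : Set E) with hA
  set P : E → E → ℝ := fun η ζ => R.stayProb W W {ζ} t η with hP
  have happ : ∀ f : E → ℝ, (∀ ζ ∉ W, f ζ = 0) → ∀ η ∈ W,
      semigroup A t f η = ∑ ζ, f ζ * P η ζ := fun f hf η hη =>
    semigroup_traceGen_apply hR hWs subset_rfl hH ht (by simpa using hη) (by simpa using hf)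
  have hsemi : ∀ z ∈ W, ∀ ζ ∈ W, semigroup A t (({ζ} : Set E).indicator 1) z = P z ζ :=
    fun z hz ζ hζ => (stayProb_eq_semigroup hR hWs subset_rfl (by simpa using hζ) hH ht
      (by simpa using hz)).symm
  -- Detailed balance for the kernel at time t, from the symmetry of the semigroup tested on
  -- indicators of points.
  have hsymm : ∀ z ∈ W, ∀ ζ ∈ W,
      (conditioned μ W z : ℝ) * P z ζ = (conditioned μ W ζ : ℝ) * P ζ z := by
    intro z hz ζ hζ
    have h1 := hrev.semigroup_symm hR hH t (({ζ} : Set E).indicator 1) (({z} : Set E).indicator 1)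
    rw [Finset.sum_eq_single z, Finset.sum_eq_single ζ] at h1
    · rw [← hA, hsemi z hz ζ hζ, hsemi ζ hζ z hz] at h1
      simp only [Set.indicator_of_mem (Set.mem_singleton _), Pi.one_apply, mul_one, one_mul] at h1
      rw [coe_conditioned, coe_conditioned, div_mul_eq_mul_div, div_mul_eq_mul_div, h1]
    · intro b _ hb
      simp [hb]
    · simp
    · intro b _ hb
      simp [hb]
    · simp
  have hexp : (2 : ℝ) ≤ Real.exp 1 := by
    have := Real.add_one_le_exp (1 : ℝ)
    linarith
  have hd : 2 * (1 / (2 * Real.exp 1)) ≤ 1 / 2 := by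
    have h2 : 2 * (1 / (2 * Real.exp 1)) = 1 / Real.exp 1 := by field_simp
    rw [h2]
    exact one_div_le_one_div_of_le two_pos hexp
  have hP0 : ∀ η ζ, 0 ≤ P η ζ := fun η ζ => R.stayProb_nonneg _ _ _ _ _
  have hPW : ∀ η, ∀ ζ ∉ W, P η ζ = 0 := fun η ζ hζ =>
    R.stayProb_singleton_of_notMem (by simpa using hζ) _ _
  -- Reversing the second half of the path turns the kernel at time 2t into π(ζ) Σ P(η, z) P(ζ, z) /
  -- π(z), an overlap of two rows close to π. The constant is (1 - 1/e)² ≥ 1/4.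
  have hlow : ∀ ζ ∈ W, (conditioned μ W ζ : ℝ) / 4 ≤ ∑ z, P z ζ * P η z := by
    intro ζ hζ
    have h1 := sq_le_sum_mul_div (by linarith) (hP0 η) (hP0 ζ)
      (sum_stayProb_singleton hR ht (by simpa using hη))
      (sum_stayProb_singleton hR ht (by simpa using hζ)) (hPW η)
      (fun z hz => hμ.conditioned_pos hR hz) (hμ.sum_conditioned hR hW)
      (h.tvDist_le hR hη) (h.tvDist_le hR hζ)
    have h2 : (1 / 4 : ℝ) ≤ (1 - 2 * (1 / (2 * Real.exp 1))) ^ 2 := by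
      have : (1 / 2 : ℝ) ≤ 1 - 2 * (1 / (2 * Real.exp 1)) := by linarith
      nlinarith
    have h3 : ∑ z, P z ζ * P η z = (conditioned μ W ζ : ℝ) *
        ∑ z ∈ W, P η z * P ζ z / (conditioned μ W z : ℝ) := by
      rw [← Finset.sum_subset (Finset.subset_univ W)
        (fun z _ hz => by rw [hPW η z hz, mul_zero]), Finset.mul_sum]
      refine Finset.sum_congr rfl fun z hz => ?_
      have h4 := (hμ.conditioned_pos hR hz).ne'
      have h5 := hsymm z hz ζ hζ
      rw [← mul_div_assoc, eq_div_iff h4]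
      linear_combination (P η z) * h5
    rw [h3]
    have h6 := mul_le_mul_of_nonneg_left (h2.trans h1) (hμ.conditioned_pos hR hζ).le
    linarith
  have hstay : R.stayProb W W B (2 * t) η =
      semigroup A t (semigroup A t ((B : Set E).indicator 1)) η := by
    rw [stayProb_eq_semigroup hR hWs subset_rfl (by simpa using hBW) hH (by positivity)
      (by simpa using hη), two_mul, semigroup_add]
  have hB1 : ∀ ζ ∉ W, (B : Set E).indicator (1 : E → ℝ) ζ = 0 := fun ζ hζ =>
    Set.indicator_of_notMem (by simpa using fun h => hζ (hBW h)) _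
  have hB2 : ∀ ζ ∉ W, semigroup A t ((B : Set E).indicator 1) ζ = 0 := fun ζ hζ => by
    rw [hA, semigroup_killedGen_apply_notMem (by simpa using hζ), hB1 ζ hζ]
  rw [hstay, happ _ hB2 η hη, coe_mass_conditioned μ W B, Finset.sum_div]
  have hsum : ∑ z, semigroup A t ((B : Set E).indicator 1) z * P η z =
      ∑ ζ, (B : Set E).indicator 1 ζ * ∑ z, P z ζ * P η z := by
    simp only [Finset.mul_sum]
    rw [Finset.sum_comm]
    refine Finset.sum_congr rfl fun z _ => ?_
    by_cases hz : z ∈ W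
    · rw [happ _ hB1 z hz, Finset.sum_mul]
      exact Finset.sum_congr rfl fun ζ _ => by ring
    · simp [hPW η z hz]
  rw [hsum]
  refine Finset.sum_le_sum fun ζ _ => ?_
  by_cases hζ : ζ ∈ B
  · simpa [hζ] using hlow ζ (hBW hζ)
  · simp [hζ]

/-- The bound on the hitting time in terms of the mixing time. -/
lemma IsMixedAt.mul_stayProb_le (hR : R.Irreducible) (hμ : R.IsStationary μ) {t : ℝ}
    (ht : 0 ≤ t) (h : R.IsMixedAt μ W t) (hB : B.Nonempty) (hBW : B ⊆ W) {η : E} (hη : η ∈ W)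
    {δ : ℝ} (hδ : 0 ≤ δ) :
    δ * R.stayProb W (W \ B) (W \ B) δ η ≤ 4 * (t / (mass (conditioned μ W) B : ℝ) *
      (1 + Real.log (1 / (mass (conditioned μ W) B : ℝ)))) := by
  set m : ℝ := (mass (conditioned μ W) B : ℝ) with hm
  have hm0 : 0 < m := hμ.mass_conditioned_pos hR hB hBW
  have hm1 : m ≤ 1 := hμ.mass_conditioned_le_one hR hB hBW
  -- The number of mixing times for which exp(-k) ≤ m / 2, leaving a probability of at least m / 2.
  -- Since k ≤ 2 (1 + ln(1/m)), the quotient k t / (m / 2) produces the constant 4.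
  set k : ℕ := ⌈Real.log (2 / m)⌉₊ with hk
  have hlog : Real.log (2 / m) = Real.log 2 + Real.log (1 / m) := by
    rw [← Real.log_mul two_ne_zero (by positivity)]
    congr 1
    ring
  have hl0 : 0 ≤ Real.log (1 / m) := Real.log_nonneg (by rw [le_div_iff₀ hm0]; linarith)
  have hl2 : Real.log 2 ≤ 1 := by
    have := Real.log_le_sub_one_of_pos (x := 2) two_pos
    linarith
  have hl2' : 0 ≤ Real.log 2 := Real.log_nonneg one_le_two
  have hk1 : (k : ℝ) ≤ 2 * (1 + Real.log (1 / m)) := by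
    have := (Nat.ceil_lt_add_one (a := Real.log (2 / m)) (by rw [hlog]; positivity)).le
    rw [← hk] at this
    linarith
  have hk2 : Real.exp (-k) ≤ m / 2 := by
    have h1 : Real.log (2 / m) ≤ k := Nat.le_ceil _
    calc Real.exp (-k) ≤ Real.exp (-Real.log (2 / m)) := Real.exp_le_exp.2 (by linarith)
      _ = m / 2 := by rw [Real.exp_neg, Real.exp_log (by positivity), inv_div]
  have hc : ∀ ζ ∈ (W : Set E), m / 2 ≤ R.stayProb W W B (k * t) ζ := fun ζ hζ => by
    have := h.le_stayProb hR hμ ht hB hBW k (by simpa using hζ)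
    linarith
  refine (mul_stayProb_le_div hR (by simpa using hB) (by simpa using hBW) (by positivity)
    (by positivity) hc (by simpa using hη) hδ).trans ?_
  have h1 : (k : ℝ) * t / (m / 2) = k * (2 * (t / m)) := by field_simp
  rw [h1]
  have h2 : (k : ℝ) * (2 * (t / m)) ≤ 2 * (1 + Real.log (1 / m)) * (2 * (t / m)) :=
    mul_le_mul_of_nonneg_right hk1 (by positivity)
  linarith

/-- The bound on the hitting time in terms of the mixing time, for reversible chains. -/
lemma IsMixedAt.mul_stayProb_le_of_reversible (hR : R.Irreducible) (hμ : R.IsStationary μ)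
    (hrev : R.Reversible μ) {t : ℝ} (ht : 0 ≤ t) (h : R.IsMixedAt μ W t) (hB : B.Nonempty)
    (hBW : B ⊆ W) {η : E} (hη : η ∈ W) {δ : ℝ} (hδ : 0 ≤ δ) :
    δ * R.stayProb W (W \ B) (W \ B) δ η ≤ 8 * (t / (mass (conditioned μ W) B : ℝ)) := by
  have hm0 := hμ.mass_conditioned_pos hR hB hBW
  refine (mul_stayProb_le_div hR (by simpa using hB) (by simpa using hBW) (t := 2 * t)
    (by positivity) (c := (mass (conditioned μ W) B : ℝ) / 4) (by positivity)
    (fun ζ hζ => h.le_stayProb_of_reversible hR hμ hrev ht hBW (by simpa using hζ))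
    (by simpa using hη) hδ).trans (le_of_eq ?_)
  field_simp
  ring

end MixingTime

end JumpRates

/-! ### From bounds for one chain to the limit. -/

namespace JumpRates

lemma Irreducible.speedUp {E : Type*} {R : JumpRates E} (hR : R.Irreducible) {θ : ℝ≥0}
    (hθ : 0 < θ) : (R.speedUp θ).Irreducible := fun η ζ =>
  Relation.ReflTransGen.mono (r := fun a b => 0 < R.rate a b)
    (fun _ _ h => mul_pos hθ h) _ _ (hR η ζ)

lemma Reversible.speedUp {E : Type*} {R : JumpRates E} {μ : E → ℝ≥0} (hR : R.Reversible μ)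
    (θ : ℝ≥0) : (R.speedUp θ).Reversible μ := fun η ζ => by
  have := hR η ζ
  simp only [JumpRates.speedUp]
  rw [mul_left_comm, this, mul_left_comm]

section

variable {E : Type*} [Fintype E] [MeasurableSpace E] [MeasurableSingletonClass E]
  {R : JumpRates E} {μ : E → ℝ≥0} {W B : Finset E}

/-- Passing to the infimum avoids asking whether the mixing time is attained or finite; K is
invertible in `ℝ≥0∞`, so it can be moved across the inequality. -/
lemma le_traceMixingTime_mul {x K : ℝ≥0∞} (hK0 : K ≠ 0) (hK : K ≠ ⊤)
    (h : ∀ t : ℝ, 0 < t → R.IsMixedAt μ W t → x ≤ ENNReal.ofReal t * K) :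
    x ≤ traceMixingTime R μ W * K := by
  rw [← ENNReal.div_le_iff hK0 hK]
  exact le_iInf fun t => le_iInf fun ht => le_iInf fun hm =>
    (ENNReal.div_le_iff hK0 hK).2 (h t ht hm)

variable [Nontrivial E]

lemma law_lt_traceHittingTime_le_mixing (hR : R.Irreducible) (hμ : R.IsStationary μ)
    (hB : B.Nonempty) (hBW : B ⊆ W) {η : E} (hη : η ∈ W) {δ : ℝ} (hδ : 0 < δ) :
    R.law η {ω | ENNReal.ofReal δ < traceHittingTime (R.chain ω) (W : Set E) (B : Set E)} ≤
      ENNReal.ofReal (4 / δ) * (traceMixingTime R μ W / (mass (conditioned μ W) B : ℝ≥0∞) *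
        ENNReal.ofReal (1 + Real.log (1 / (mass (conditioned μ W) B : ℝ)))) := by
  have hm0 := hμ.mass_conditioned_pos hR hB hBW
  have hm1 := hμ.mass_conditioned_le_one hR hB hBW
  have hl : 0 < 1 + Real.log (1 / (mass (conditioned μ W) B : ℝ)) := by
    have : 0 ≤ Real.log (1 / (mass (conditioned μ W) B : ℝ)) :=
      Real.log_nonneg (by rw [le_div_iff₀ hm0]; linarith)
    linarith
  set K : ℝ := 4 / δ * (1 + Real.log (1 / (mass (conditioned μ W) B : ℝ))) *
    (mass (conditioned μ W) B : ℝ)⁻¹ with hK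
  have hK0 : 0 < K := by positivity
  refine (law_lt_traceHittingTime_le hR (by simpa using hB.mono hBW) _ δ η).trans ?_
  refine (le_traceMixingTime_mul (R := R) (μ := μ) (W := W)
    (ENNReal.ofReal_pos.2 hK0).ne' ENNReal.ofReal_ne_top fun t ht hmix => ?_).trans (le_of_eq ?_)
  · rw [← ENNReal.ofReal_mul ht.le]
    refine ENNReal.ofReal_le_ofReal ?_
    have h1 := IsMixedAt.mul_stayProb_le hR hμ ht.le hmix hB hBW hη hδ.le
    rw [← le_div_iff₀' hδ] at h1
    refine h1.trans (le_of_eq ?_)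
    rw [hK]
    field_simp
  · rw [hK, ENNReal.ofReal_mul (by positivity), ENNReal.ofReal_mul (by positivity),
      ENNReal.ofReal_inv_of_pos hm0, ENNReal.ofReal_coe_nnreal,
      div_eq_mul_inv (traceMixingTime R μ W)]
    ring

lemma law_lt_traceHittingTime_le_mixing_of_reversible (hR : R.Irreducible)
    (hμ : R.IsStationary μ) (hrev : R.Reversible μ) (hB : B.Nonempty) (hBW : B ⊆ W) {η : E}
    (hη : η ∈ W) {δ : ℝ} (hδ : 0 < δ) :
    R.law η {ω | ENNReal.ofReal δ < traceHittingTime (R.chain ω) (W : Set E) (B : Set E)} ≤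
      ENNReal.ofReal (8 / δ) *
        (traceMixingTime R μ W / (mass (conditioned μ W) B : ℝ≥0∞)) := by
  have hm0 := hμ.mass_conditioned_pos hR hB hBW
  set K : ℝ := 8 / δ * (mass (conditioned μ W) B : ℝ)⁻¹ with hK
  have hK0 : 0 < K := by positivity
  refine (law_lt_traceHittingTime_le hR (by simpa using hB.mono hBW) _ δ η).trans ?_
  refine (le_traceMixingTime_mul (R := R) (μ := μ) (W := W)
    (ENNReal.ofReal_pos.2 hK0).ne' ENNReal.ofReal_ne_top fun t ht hmix => ?_).trans (le_of_eq ?_)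
  · rw [← ENNReal.ofReal_mul ht.le]
    refine ENNReal.ofReal_le_ofReal ?_
    have h1 := IsMixedAt.mul_stayProb_le_of_reversible hR hμ hrev ht.le hmix hB hBW hη hδ.le
    rw [← le_div_iff₀' hδ] at h1
    refine h1.trans (le_of_eq ?_)
    rw [hK]
    field_simp
  · rw [hK, ENNReal.ofReal_mul (by positivity),
      ENNReal.ofReal_inv_of_pos hm0, ENNReal.ofReal_coe_nnreal,
      div_eq_mul_inv (traceMixingTime R μ W)]
    ring

lemma law_lt_traceHittingTime_le_iSup_capacity [DecidableEq E] (hR : R.Irreducible)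
    (hμ : R.IsStationary μ) (hB : B.Nonempty) (hBW : B ⊆ W) {η : E} (hη : η ∈ W) {δ : ℝ}
    (hδ : 0 < δ) :
    R.law η {ω | ENNReal.ofReal δ < traceHittingTime (R.chain ω) (W : Set E) (B : Set E)} ≤
      ENNReal.ofReal δ⁻¹ *
        ⨆ ζ ∈ W \ B, (mass μ (W \ B) : ℝ≥0∞) / R.capacity μ {ζ} B := by
  by_cases hηB : η ∈ B
  · refine (law_lt_traceHittingTime_le hR (by simpa using hB.mono hBW) _ δ η).trans ?_
    rw [R.stayProb_of_mem_of_notMem (by simpa using hη) (fun h => h.2 (by simpa using hηB)),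
      ENNReal.ofReal_zero]
    exact zero_le
  · have hηS : η ∈ W \ B := Finset.mem_sdiff.2 ⟨hη, hηB⟩
    refine (law_lt_traceHittingTime_le_capacity hR hμ hB hBW hηS hδ).trans ?_
    gcongr
    exact le_iSup₂ (f := fun ζ (_ : ζ ∈ W \ B) =>
      (mass μ (W \ B) : ℝ≥0∞) / R.capacity μ {ζ} B) η hηS

end

end JumpRates

section Limits

variable {E : ℕ → Type*} [∀ N, Fintype (E N)] [∀ N, MeasurableSpace (E N)]
  [∀ N, MeasurableSingletonClass (E N)]

/-- Condition (M1) follows from a bound for every well. -/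
lemma conditionM1_of_forall_le {S : Type*} [Fintype S] {R : ∀ N, JumpRates (E N)}
    {W B : ∀ N, S → Finset (E N)}
    (h : ∀ x, ∀ δ : ℝ, 0 < δ → ∃ C : ℝ≥0∞, C ≠ ⊤ ∧ ∃ q : ℕ → ℝ≥0∞, Tendsto q atTop (𝓝 0) ∧
      ∀ N, ∀ η ∈ W N x, (R N).law η {ω | ENNReal.ofReal δ <
        traceHittingTime ((R N).chain ω) (W N x : Set (E N)) (B N x : Set (E N))} ≤ C * q N) :
    ConditionM1 R W B := by
  intro δ hδ
  choose C hC q hq hle using fun x => h x δ hδ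
  -- With finitely many wells, the supremum over x is dominated by a sum. The choice among the
  -- conditions may thus depend on the well.
  have hlim : Tendsto (fun N => ∑ x, C x * q x N) atTop (𝓝 0) := by
    have : Tendsto (fun N => ∑ x, C x * q x N) atTop (𝓝 (∑ x, C x * 0)) :=
      tendsto_finsetSum _ fun x _ => ENNReal.Tendsto.const_mul (hq x) (Or.inr (hC x))
    simpa using this
  refine tendsto_of_tendsto_of_tendsto_of_le_of_le tendsto_const_nhds hlim
    (fun _ => zero_le) fun N => ?_
  refine iSup_le fun x => iSup₂_le fun η hη => (hle x N η hη).trans ?_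
  exact Finset.single_le_sum (f := fun x => C x * q x N) (fun _ _ => zero_le) (Finset.mem_univ x)

end Limits

end Metastable

end
open Metastable in
theorem lemma3p9 {n : ℕ} (hn : 2 ≤ n) (E : ℕ → Type*)
    [∀ N, Fintype (E N)] [∀ N, DecidableEq (E N)] [∀ N, MeasurableSpace (E N)]
    [∀ N, MeasurableSingletonClass (E N)]
    -- the chains `η^N`, the time-scale `θ_N`, and the chains `ξ^N(t) = η^N(θ_N t)`
    (r : ∀ N, JumpRates (E N)) (hr : ∀ N, (r N).Irreducible)
    (θ : ℕ → ℝ≥0) (hθ : ∀ N, 0 < θ N)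
    (R : ∀ N, JumpRates (E N)) (hR : ∀ N, R N = (r N).speedUp (θ N))
    -- the stationary state of `ξ^N`
    (μ : ∀ N, E N → ℝ≥0) (hμ : ∀ N, (R N).IsStationary (μ N))
    -- the wells, and the subsets of the wells
    (W : ∀ N, Fin n → Finset (E N)) (hW : ∀ N, Pairwise fun x y => Disjoint (W N x) (W N y))
    (B : ∀ N, Fin n → Finset (E N)) (hB : ∀ N x, (B N x).Nonempty) (hBW : ∀ N x, B N x ⊆ W N x) :
    ((∀ x, CapacityCondition R μ (fun N => W N x) (fun N => B N x) ∨
        MixingCondition R μ (fun N => W N x) (fun N => B N x)) →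
      ConditionM1 R W B) ∧
    ((∀ N, (r N).Reversible (μ N)) →
      (∀ x, CapacityCondition R μ (fun N => W N x) (fun N => B N x) ∨
        MixingConditionNoLog R μ (fun N => W N x) (fun N => B N x)) →
      ConditionM1 R W B) := by
  have hirr : ∀ N, (R N).Irreducible := fun N => by
    rw [hR N]; exact (hr N).speedUp (hθ N)
  -- Two disjoint non-empty wells provide two configurations, so irreducibility excludes absorbing
  -- points and all holding rates are positive.
  have hnt : ∀ N, Nontrivial (E N) := fun N => by
    obtain ⟨a, ha⟩ := hB N ⟨0, by omega⟩
    obtain ⟨b, hb⟩ := hB N ⟨1, by omega⟩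
    refine ⟨a, b, ?_⟩
    rintro rfl
    exact Finset.disjoint_left.1 (hW N (i := ⟨0, by omega⟩) (j := ⟨1, by omega⟩) (by simp))
      (hBW N _ ha) (hBW N _ hb)
  have hcap : ∀ x, CapacityCondition R μ (fun N => W N x) (fun N => B N x) →
      ∀ δ : ℝ, 0 < δ → ∃ C : ℝ≥0∞, C ≠ ⊤ ∧ ∃ q : ℕ → ℝ≥0∞, Tendsto q atTop (𝓝 0) ∧
      ∀ N, ∀ η ∈ W N x, (R N).law η {ω | ENNReal.ofReal δ <
        traceHittingTime ((R N).chain ω) (W N x : Set (E N)) (B N x : Set (E N))} ≤ C * q N :=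
    fun x hx δ hδ => ⟨_, ENNReal.ofReal_ne_top, _, hx, fun N _ hη =>
      JumpRates.law_lt_traceHittingTime_le_iSup_capacity (hirr N) (hμ N) (hB N x) (hBW N x) hη hδ⟩
  refine ⟨fun h => conditionM1_of_forall_le fun x δ hδ => ?_,
    fun hrev h => conditionM1_of_forall_le fun x δ hδ => ?_⟩
  · rcases h x with hx | hx
    · exact hcap x hx δ hδ
    · exact ⟨_, ENNReal.ofReal_ne_top, _, hx, fun N _ hη =>
        JumpRates.law_lt_traceHittingTime_le_mixing (hirr N) (hμ N) (hB N x) (hBW N x) hη hδ⟩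
  · rcases h x with hx | hx
    · exact hcap x hx δ hδ
    · refine ⟨ENNReal.ofReal (8 / δ), ENNReal.ofReal_ne_top, _, hx, fun N _ hη => ?_⟩
      refine JumpRates.law_lt_traceHittingTime_le_mixing_of_reversible (hirr N) (hμ N) ?_ (hB N x)
        (hBW N x) hη hδ
      rw [hR N]
      exact (hrev N).speedUp (θ N)
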